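/- Let $n\ge 2$ and $X_n=\{0,\dots,n-1\}$. A transducer $T$ over $X_n$ has a state set $Q_T$, a transition function $\pi_T:X_n\times Q_T\to Q_T$ and an output function $\lambda_T:X_n\times Q_T\to X_n^*$, both extended to words. It is assumed to write an infinite word on reading an infinite word, so that each state $q$ induces a map $h_q:X_n^{\omega}\to X_n^{\omega}$. It is *strongly synchronizing* if for some $k$ every word of length $k$ takes all states to one state; the states obtained in this way form its *core*, and it is *core* if every state belongs to its core. It is *minimal* if it is strongly connected, distinct states induce distinct maps, and for every state $q$ the outputs $h_q(x)$, $x\in X_n^\omega$, have no common non-empty prefix. The *minimal representative* of a strongly connected transducer is obtained by replacing $\lambda_T(x,q)$ by $\Lambda(x,q)-\Lambda(\varepsilon,q)$, where $\Lambda(w,q)$ is the greatest common prefix of $\{h_q(wz): z\in X_n^\omega\}$ (assumed finite), and then identifying states that induce the same map. Two minimal transducers are regarded as equal if there is a bijection between their state sets under which corresponding states induce the same map. Let $\widetilde{\mathcal O}_n$ be the monoid of finite, minimal, strongly synchronizing, core transducers all of whose states induce injective maps with clopen image; the product $TU$ is the minimal representative of the core of the transducer that feeds the output of $T$ into $U$.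 Let $\mathcal O_n$ be the group of elements of $\widetilde{\mathcal O}_n$ that have an inverse in $\widetilde{\mathcal O}_n$, and let $\mathcal H_n\subseteq\mathcal O_n$ be the set of synchronous elements (each letter read produces exactly one letter) all of whose states induce homeomorphisms of $X_n^\omega$. For $T\in\mathcal O_n$ let $\overleftarrow{T}$ be the non-deterministic transducer with state set $Q_T$ and with an edge from $\pi_T(x,p)$ to $p$, with input label $x$ and output label the reversal of $\lambda_T(x,p)$, for each $x\in X_n$ and $p\in Q_T$. For a state $q$ and a word $w\ne\varepsilon$ let $(w)L_q$ be the greatest common prefix of all infinite paths of $\overleftarrow{T}$ that start at $q$ and whose input label has prefix $w$, and let $(\varepsilon)L_q=\varepsilon$. Let $\mathrm{rec}(\overleftarrow{T})$ be the deterministic transducer whose states are the pairs $(w,q)$ with $(w)L_q=\varepsilon$ such that every infinite word with prefix $w$ can be read from $q$ in $\overleftarrow{T}$. Reading $x$ in the state $(w,q)$, it writes the output of the path $(wx)L_q$ and moves to $(wx-y,p)$, where $y$ is the input label and $p$ the end of that path. Let $\overleftarrow{\mathfrak r}(T)$ be the minimal representative of $\mathrm{rec}(\overleftarrow{T})$;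 the map $\overleftarrow{\mathfrak r}$ is the reversing automorphism of $\mathcal O_n$. **Proposition.** Let $T\in\mathcal H_n$. Then $\overleftarrow{\mathfrak r}(T)\in\mathcal H_n$ if and only if the minimal representative of $T$ has exactly one state. Moreover, if $n\ge 3$, then $\overleftarrow{\mathfrak r}$ is non-trivial: there is $T\in\mathcal O_n$ with $\overleftarrow{\mathfrak r}(T)\in\mathcal O_n$ and $\overleftarrow{\mathfrak r}(T)\ne T$. -/

import Mathlib

open Classical in
/-- The greatest common prefix of a set of infinite sequences: its length is the largest `k` such
that all members of the set agree on their first `k` entries.  (Convention: `[]` if the set is empty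
or a singleton, when there is no finite greatest common prefix.) -/
noncomputable def greatestCommonPrefix {α : Type} (S : Set (ℕ → α)) : List α :=
  if h : S.Nonempty then
    (List.range (sSup {k : ℕ | ∀ s ∈ S, ∀ t ∈ S, ∀ i < k, s i = t i})).map h.some
  else []

/-- The length `k` prefix of an infinite sequence. -/
def seqPrefix {α : Type} (x : ℕ → α) (k : ℕ) : List α := (List.range k).map x

/-- The cone `U_w` of all infinite words with prefix `w`. -/
def cone {n : ℕ} (w : List (Fin n)) : Set (ℕ → Fin n) := {x | seqPrefix x w.length = w}

/-- Prepend a finite word to an infinite word. -/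
def prependWord {n : ℕ} (w : List (Fin n)) (x : ℕ → Fin n) : ℕ → Fin n :=
  fun i => if h : i < w.length then w[i] else x (i - w.length)

/-! ### Deterministic transducers over the alphabet `X_n = {0, …, n-1}` -/

/-- A (deterministic, possibly asynchronous, non-initial) transducer: in state `q`, reading the
letter `x`, it writes the word `out x q` and moves to the state `trans x q`. Finiteness of the state
set and the standing non-degeneracy assumption are imposed in `Transducer.MemSO`. -/
structure Transducer (n : ℕ) where
  Q : Type
  trans : Fin n → Q → Q
  out : Fin n → Q → List (Fin n)

namespace Transducer

variable {n : ℕ}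

/-- The transition function on words. -/
def run (T : Transducer n) : List (Fin n) → T.Q → T.Q
  | [], q => q
  | x :: w, q => T.run w (T.trans x q)

/-- The output function on words. -/
def outWord (T : Transducer n) : List (Fin n) → T.Q → List (Fin n)
  | [], _ => []
  | x :: w, q => T.out x q ++ T.outWord w (T.trans x q)

/-- On reading an infinite word from any state, an infinite word is written. -/
def Nondegenerate (T : Transducer n) : Prop :=
  ∀ (q : T.Q) (x : ℕ → Fin n) (m : ℕ), ∃ k, m ≤ (T.outWord (seqPrefix x k) q).length

open Classical in
/-- The map `X_n^ω → X_n^ω` induced by the state `q`: the `i`-th letter of the output is the `i`-th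
letter of the output of any sufficiently long prefix. (The last branch is not reached for
non-degenerate transducers.) -/
noncomputable def stateMap (T : Transducer n) (q : T.Q) (x : ℕ → Fin n) : ℕ → Fin n := fun i =>
  if h : ∃ k, i < (T.outWord (seqPrefix x k) q).length then
    (T.outWord (seqPrefix x (Nat.find h)) q)[i]'(Nat.find_spec h)
  else x 0

/-- The state `q` is a homeomorphism state. -/
def IsHomeoState (T : Transducer n) (q : T.Q) : Prop := IsHomeomorph (T.stateMap q)

/-- `Λ(w, q)`: the greatest common prefix of the outputs from `q` of all infinite words with
prefix `w`. -/
noncomputable def Lam (T : Transducer n) (w : List (Fin n)) (q : T.Q) : List (Fin n) :=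
  greatestCommonPrefix (Set.range fun x : ℕ → Fin n => T.stateMap q (prependWord w x))

/-- Synchronizing at level `k`: each word of length `k` forces a state. -/
def SyncAt (T : Transducer n) (k : ℕ) : Prop :=
  ∀ w : List (Fin n), w.length = k → ∀ p q : T.Q, T.run w p = T.run w q

def StronglySynchronizing (T : Transducer n) : Prop := ∃ k, T.SyncAt k

/-- The states in the image of a synchronizing map (this image does not depend on the level). -/
def coreStates (T : Transducer n) : Set T.Q :=
  {q | ∃ k, T.SyncAt k ∧ ∃ w : List (Fin n), w.length = k ∧ ∀ p, T.run w p = q}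

/-- A transducer is core if it is equal to its core. -/
def IsCore (T : Transducer n) : Prop := T.coreStates = Set.univ

theorem run_append (T : Transducer n) (v w : List (Fin n)) (q : T.Q) :
    T.run (v ++ w) q = T.run w (T.run v q) := by
  induction v generalizing q with
  | nil => rfl
  | cons x v ih => exact ih (T.trans x q)

theorem trans_mem_coreStates (T : Transducer n) {q : T.Q} (hq : q ∈ T.coreStates) (x : Fin n) :
    T.trans x q ∈ T.coreStates := by
  obtain ⟨k, hk, w, hw, hwq⟩ := hq
  refine ⟨k + 1, ?_, w ++ [x], by simp [hw], fun p => ?_⟩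
  · intro v hv p p'
    cases v with
    | nil => simp at hv
    | cons y v => exact hk v (by simpa using hv) _ _
  · rw [run_append, hwq p]
    rfl

/-- The core of a transducer, as a transducer in its own right. -/
def core (T : Transducer n) : Transducer n where
  Q := T.coreStates
  trans x q := ⟨T.trans x q.1, T.trans_mem_coreStates q.2 x⟩
  out x q := T.out x q.1

/-- No two distinct states induce the same map. -/
def WeaklyMinimal (T : Transducer n) : Prop :=
  ∀ p q : T.Q, T.stateMap p = T.stateMap q → p = q

def StronglyConnected (T : Transducer n) : Prop := ∀ p q : T.Q, ∃ w, T.run w p = q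

/-- A non-initial transducer is minimal if it is weakly minimal, has no states of incomplete
response, and is strongly connected. -/
def Minimal (T : Transducer n) : Prop :=
  T.WeaklyMinimal ∧ (∀ q, T.Lam [] q = []) ∧ T.StronglyConnected

/-- `ω`-equality of (minimal) non-initial transducers: a bijection between the states under which
corresponding states induce the same map. -/
def OmegaEq (T U : Transducer n) : Prop :=
  ∃ f : T.Q ≃ U.Q, ∀ q, T.stateMap q = U.stateMap (f q)

/-- Removing incomplete response: the new output is `Λ(x, q) - Λ(ε, q)`. -/
noncomputable def removeIncomplete (T : Transducer n) : Transducer n where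
  Q := T.Q
  trans := T.trans
  out x q := (T.Lam [x] q).drop (T.Lam [] q).length

/-- `ω`-equivalence of the states of a transducer. -/
def omegaSetoid (T : Transducer n) : Setoid T.Q where
  r p q := T.stateMap p = T.stateMap q
  iseqv := ⟨fun _ => rfl, fun h => h.symm, fun h h' => h.trans h'⟩

/-- Identifying `ω`-equivalent states. Where there is no incomplete response, equivalent states have
equal outputs and equivalent successors, so that the choice of representatives is immaterial. -/
noncomputable def identifyStates (T : Transducer n) : Transducer n where
  Q := Quotient T.omegaSetoid
  trans x c := Quotient.mk T.omegaSetoid (T.trans x c.out)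
  out x c := T.out x c.out

/-- The minimal representative of a (strongly connected) transducer whose states have finite extent
of incomplete response: remove incomplete response, then identify `ω`-equivalent states. -/
noncomputable def minRep (T : Transducer n) : Transducer n := T.removeIncomplete.identifyStates

/-- The full product `T * U`: the output of `T` is the input of `U`. -/
def fullProduct (T U : Transducer n) : Transducer n where
  Q := T.Q × U.Q
  trans x s := (T.trans x s.1, U.run (T.out x s.1) s.2)
  out x s := U.outWord (T.out x s.1) s.2

/-- The product `TU` in the monoid of transducers: the minimal representative of the core of
`T * U`. (It is used only for transducers with injective states, for which no state of `T * U` has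
infinite extent of incomplete response.) -/
noncomputable def product (T U : Transducer n) : Transducer n := (T.fullProduct U).core.minRep

/-- The single state identity transducer. -/
def identity (n : ℕ) : Transducer n where
  Q := Unit
  trans _ q := q
  out x _ := [x]

/-- The monoid of finite, non-degenerate, minimal, strongly synchronizing and core transducers, all
of whose states induce injective maps with clopen image (for `n ≥ 2`). -/
structure MemSO (T : Transducer n) : Prop where
  finite : Finite T.Q
  nonempty : Nonempty T.Q
  nondegenerate : T.Nondegenerate
  minimal : T.Minimal
  stronglySynchronizing : T.StronglySynchronizing
  isCore : T.IsCore
  injective : ∀ q, Function.Injective (T.stateMap q)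
  clopen_image : ∀ q, IsClopen (Set.range (T.stateMap q))

/-- The group `𝒪_n`: the largest inverse closed subset of the monoid above. -/
def MemO (T : Transducer n) : Prop :=
  T.MemSO ∧ ∃ U : Transducer n, U.MemSO ∧
    (T.product U).OmegaEq (identity n) ∧ (U.product T).OmegaEq (identity n)

/-- Every letter read produces exactly one letter. -/
def Synchronous (T : Transducer n) : Prop := ∀ x q, (T.out x q).length = 1

/-- The group `ℋ_n`: the synchronous elements of `𝒪_n` all of whose states are homeomorphism
states. -/
def MemH (T : Transducer n) : Prop :=
  T.MemO ∧ T.Synchronous ∧ ∀ q, T.IsHomeoState q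

end Transducer

/-! ### Non-deterministic transducers -/

/-- A non-deterministic transducer, as a labelled digraph with vertex set `Q` and edge set `E`: the
edge `e` runs from `src e` to `tgt e`, has input label `label e` and output label `out e`. -/
structure NDTransducer (n : ℕ) where
  Q : Type
  E : Type
  src : E → Q
  tgt : E → Q
  label : E → List (Fin n)
  out : E → List (Fin n)

namespace NDTransducer

variable {n : ℕ}

/-- The list of edges is a path that starts at `q`. -/
def IsPath (N : NDTransducer n) : N.Q → List N.E → Prop
  | _, [] => True
  | q, e :: p => N.src e = q ∧ N.IsPath (N.tgt e) p

/-- The end of a path that starts at `q`. -/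
def endState (N : NDTransducer n) : N.Q → List N.E → N.Q
  | q, [] => q
  | _, e :: p => N.endState (N.tgt e) p

/-- The input label of a path. -/
def pathLabel (N : NDTransducer n) (p : List N.E) : List (Fin n) := p.flatMap N.label

/-- The output of a path. -/
def pathOut (N : NDTransducer n) (p : List N.E) : List (Fin n) := p.flatMap N.out

/-- The domain of a state: the infinite words each of whose finite prefixes is a prefix of the input
label of some path that starts at `q`. -/
def dom (N : NDTransducer n) (q : N.Q) : Set (ℕ → Fin n) :=
  {x | ∀ k, ∃ p, N.IsPath q p ∧ seqPrefix x k <+: N.pathLabel p}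

/-- The infinite paths that start at `q` and whose input label has the prefix `w`. -/
def infinitePaths (N : NDTransducer n) (q : N.Q) (w : List (Fin n)) : Set (ℕ → N.E) :=
  {s | N.src (s 0) = q ∧ (∀ i, N.tgt (s i) = N.src (s (i + 1))) ∧
    ∃ k, w <+: N.pathLabel (seqPrefix s k)}

/-- `(w)L_q`: the greatest common prefix of all infinite paths that start at `q` and whose input
label has the prefix `w`; by convention `(ε)L_q = ε`. -/
noncomputable def L (N : NDTransducer n) (q : N.Q) (w : List (Fin n)) : List N.E :=
  if w = [] then [] else greatestCommonPrefix (N.infinitePaths q w)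

/-- The states of the recovered deterministic transducer. -/
def recStates (N : NDTransducer n) : Set (List (Fin n) × N.Q) :=
  {s | cone s.1 ⊆ N.dom s.2 ∧ N.L s.2 s.1 = []}

open Classical in
/-- The deterministic transducer recovered from a core strongly synchronizing non-deterministic
transducer: reading `x` in the state `(w, q)`, it writes the output of the path `(wx)L_q` and moves
to `(wx - y, p)`, where `y` is the input label of that path and `p` is its end. (For `n ≥ 2` that
pair is again a state, and the `else` branch is not reached.) -/
noncomputable def recover (N : NDTransducer n) : Transducer n where
  Q := N.recStates
  trans x s :=
    let p := N.L s.1.2 (s.1.1 ++ [x])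
    if h : ((s.1.1 ++ [x]).drop (N.pathLabel p).length, N.endState s.1.2 p) ∈ N.recStates then
      ⟨_, h⟩
    else s
  out x s := N.pathOut (N.L s.1.2 (s.1.1 ++ [x]))

end NDTransducer

namespace Transducer

variable {n : ℕ}

/-- The reverse of a transducer: each edge `p → trans x p` labelled `x | out x p` is replaced by an
edge `trans x p → p`, with input label `x` and the reversed output. -/
def reverse (T : Transducer n) : NDTransducer n where
  Q := T.Q
  E := Fin n × T.Q
  src e := T.trans e.1 e.2
  tgt e := e.2
  label e := [e.1]
  out e := (T.out e.1 e.2).reverse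

/-- The reversing map: the minimal representative of the deterministic transducer recovered from the
reverse of `T`. -/
noncomputable def revRec (T : Transducer n) : Transducer n := T.reverse.recover.minRep

end Transducer

/-! A left infinite input word is written as a sequence x = (x₀, x₁, …) in which x₀ is the letter
read last. If T synchronizes at level k, such a word labels exactly one left infinite path of T. A
synchronous T therefore defines a map F, here `pastOut`, on infinite words, and F commutes with
deletion of the first entry. The bridge to the reversing map is `recover_stateMap`: the state (w, q)
of the recovered transducer induces y ↦ F(wy). Passing to the minimal representative strips the
greatest common prefix of these values.

Suppose that T and its image under the reversing map both lie in ℋ_n. An inverse of T synchronizes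
on the outputs of T, so long outputs determine the state of T (`MemO.exists_output_sync`) and F is
injective (`pastOut_injective`). Write F(wy) = u h(y) for one state (w, q), where u is the greatest
common prefix and h is surjective and synchronous. Surjectivity of h and injectivity of F force |w|
≤ |u|. Put d = |u| - |w|. The first letter of h(y) depends only on y₀, but it is also what T writes
on reading y_d after the past y_{d+1}, y_{d+2}, …. For y = a a^d t, with t an arbitrary past, the
output letter of T at a is thus the same in all states. Hence all states induce one map, and
minimality leaves a single state. Conversely, a one state T permutes letters, and its recovered
transducer has one state with the same map.

For non-triviality, let σ be a transposition that fixes a letter z, and let T apply σ to the letters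
preceded by z. Then F is an involution, because σ fixes z and so preserves the positions of z. The
recovered state with word z induces y ↦ z F(y), so F itself is a state map of the minimal
representative, which is therefore its own inverse (`product_omegaEq_identity`). For a letter b
moved by σ, the map y ↦ F(by) has no common prefix and never starts with z. It is not surjective,
whereas all states of T induce involutions. -/

/-! ### Infinite words -/

section Sequences

variable {n : ℕ}

theorem prependWord_of_lt (w : List (Fin n)) (x : ℕ → Fin n) {i : ℕ} (h : i < w.length) :
    prependWord w x i = w[i] := by
  simp [prependWord, h]

@[simp] theorem prependWord_add (w : List (Fin n)) (x : ℕ → Fin n) (i : ℕ) :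
    prependWord w x (w.length + i) = x i := by
  simp [prependWord]

@[simp] theorem prependWord_nil (x : ℕ → Fin n) : prependWord [] x = x := by
  funext i
  simp [prependWord]

@[simp] theorem prependWord_cons_zero (a : Fin n) (w : List (Fin n)) (x : ℕ → Fin n) :
    prependWord (a :: w) x 0 = a := by
  simp [prependWord]

@[simp] theorem prependWord_cons_succ (a : Fin n) (w : List (Fin n)) (x : ℕ → Fin n) (i : ℕ) :
    prependWord (a :: w) x (i + 1) = prependWord w x i := by
  simp [prependWord]

theorem prependWord_append (u v : List (Fin n)) (x : ℕ → Fin n) :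
    prependWord (u ++ v) x = prependWord u (prependWord v x) := by
  induction u with
  | nil => simp
  | cons a u ih =>
    funext i
    cases i with
    | zero => simp
    | succ i => simp [ih]

theorem prependWord_injective (w : List (Fin n)) : Function.Injective (prependWord w) := by
  intro x y h
  funext i
  simpa using congrFun h (w.length + i)

@[simp] theorem length_seqPrefix {α : Type} (x : ℕ → α) (k : ℕ) : (seqPrefix x k).length = k := by
  simp [seqPrefix]

@[simp] theorem getElem_seqPrefix {α : Type} (x : ℕ → α) (k i : ℕ)
    (h : i < (seqPrefix x k).length) : (seqPrefix x k)[i] = x i := by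
  simp [seqPrefix]

theorem seqPrefix_zero {α : Type} (x : ℕ → α) : seqPrefix x 0 = [] := rfl

theorem seqPrefix_succ {α : Type} (x : ℕ → α) (k : ℕ) :
    seqPrefix x (k + 1) = x 0 :: seqPrefix (fun i => x (i + 1)) k := by
  simp [seqPrefix, List.range_succ_eq_map, Function.comp_def]

theorem seqPrefix_add {α : Type} (x : ℕ → α) (j k : ℕ) :
    seqPrefix x (j + k) = seqPrefix x j ++ seqPrefix (fun i => x (j + i)) k := by
  simp [seqPrefix, List.range_add, Function.comp_def]

theorem seqPrefix_eq_iff {α : Type} (x : ℕ → α) (w : List α) :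
    seqPrefix x w.length = w ↔ ∀ i (h : i < w.length), x i = w[i] := by
  constructor
  · intro h i hi
    have := List.getElem_of_eq h (i := i) (by simpa using hi)
    simpa using this
  · intro h
    apply List.ext_getElem (by simp)
    intro i h1 h2
    simpa using h i h2

theorem seqPrefix_congr {α : Type} {x y : ℕ → α} {k : ℕ} :
    seqPrefix x k = seqPrefix y k ↔ ∀ i < k, x i = y i := by
  simp [seqPrefix]

theorem prependWord_seqPrefix (x : ℕ → Fin n) (k : ℕ) :
    prependWord (seqPrefix x k) (fun i => x (k + i)) = x := by
  funext i
  by_cases h : i < k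
  · rw [prependWord_of_lt _ _ (by simpa using h)]
    simp
  · obtain ⟨j, rfl⟩ := Nat.exists_eq_add_of_le (not_lt.mp h)
    simpa using prependWord_add (seqPrefix x k) (fun i => x (k + i)) j

theorem seqPrefix_prependWord (w : List (Fin n)) (x : ℕ → Fin n) (k : ℕ) :
    seqPrefix (prependWord w x) (w.length + k) = w ++ seqPrefix x k := by
  rw [seqPrefix_add]
  congr 1
  · rw [seqPrefix_eq_iff]
    intro i h
    exact prependWord_of_lt w x h
  · simp

theorem mem_cone_iff {w : List (Fin n)} {x : ℕ → Fin n} :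
    x ∈ cone w ↔ ∃ y, prependWord w y = x := by
  constructor
  · intro h
    refine ⟨fun i => x (w.length + i), ?_⟩
    have h' : seqPrefix x w.length = w := h
    conv_lhs => rw [← h']
    simpa using prependWord_seqPrefix x w.length
  · rintro ⟨y, rfl⟩
    have h := seqPrefix_prependWord w y 0
    rwa [seqPrefix_zero, List.append_nil] at h

theorem prependWord_mem_cone (w : List (Fin n)) (x : ℕ → Fin n) : prependWord w x ∈ cone w :=
  mem_cone_iff.mpr ⟨x, rfl⟩

theorem isClopen_cone (w : List (Fin n)) : IsClopen (cone w) := by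
  have : cone w = ⋂ i : Fin w.length, {x : ℕ → Fin n | x i = w[i]} := by
    ext x
    simp only [cone, Set.mem_ofPred_eq, Set.mem_iInter, seqPrefix_eq_iff]
    exact ⟨fun h i => h i i.2, fun h i hi => h ⟨i, hi⟩⟩
  rw [this]
  exact isClopen_iInter_of_finite fun i =>
    (isClopen_discrete {w[i]}).preimage (continuous_apply (i : ℕ))

theorem continuous_prependWord (w : List (Fin n)) : Continuous (prependWord w) := by
  refine continuous_pi fun i => ?_
  by_cases h : i < w.length
  · simp only [prependWord, h, dite_true]
    exact continuous_const
  · simp only [prependWord, h, dite_false]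
    exact continuous_apply _

end Sequences

/-! ### Greatest common prefixes -/

section GreatestCommonPrefix

variable {α : Type} {S : Set (ℕ → α)}

/-- Two distinct members bound the length of agreement, so the `sSup` in the definition is a maximum
and not the default value 0. This is the role of `S.Nontrivial` below. -/
theorem bddAbove_agreement (hS : S.Nontrivial) :
    BddAbove {k : ℕ | ∀ s ∈ S, ∀ t ∈ S, ∀ i < k, s i = t i} := by
  obtain ⟨s, hs, t, ht, hst⟩ := hS
  obtain ⟨i, hi⟩ := Function.ne_iff.mp hst
  exact ⟨i, fun k hk => not_lt.mp fun h => hi (hk s hs t ht i h)⟩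

theorem length_greatestCommonPrefix (hS : S.Nontrivial) :
    (greatestCommonPrefix S).length = sSup {k : ℕ | ∀ s ∈ S, ∀ t ∈ S, ∀ i < k, s i = t i} := by
  simp [greatestCommonPrefix, hS.nonempty]

theorem agree_greatestCommonPrefix (hS : S.Nontrivial) :
    ∀ s ∈ S, ∀ t ∈ S, ∀ i < (greatestCommonPrefix S).length, s i = t i := by
  rw [length_greatestCommonPrefix hS]
  exact Nat.sSup_mem (s := {k : ℕ | ∀ s ∈ S, ∀ t ∈ S, ∀ i < k, s i = t i})
    ⟨0, by simp⟩ (bddAbove_agreement hS)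

theorem seqPrefix_greatestCommonPrefix (hS : S.Nontrivial) {s : ℕ → α} (hs : s ∈ S) :
    seqPrefix s (greatestCommonPrefix S).length = greatestCommonPrefix S := by
  have h1 : greatestCommonPrefix S
      = seqPrefix hS.nonempty.some (greatestCommonPrefix S).length := by
    rw [length_greatestCommonPrefix hS]
    simp [greatestCommonPrefix, hS.nonempty, seqPrefix]
  conv_rhs => rw [h1]
  exact seqPrefix_congr.mpr (agree_greatestCommonPrefix hS s hs _ hS.nonempty.some_mem)

theorem le_length_greatestCommonPrefix (hS : S.Nontrivial) {k : ℕ}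
    (hk : ∀ s ∈ S, ∀ t ∈ S, ∀ i < k, s i = t i) : k ≤ (greatestCommonPrefix S).length := by
  rw [length_greatestCommonPrefix hS]
  exact le_csSup (bddAbove_agreement hS) hk

theorem exists_ne_at_length_greatestCommonPrefix (hS : S.Nontrivial) :
    ∃ s ∈ S, ∃ t ∈ S, s (greatestCommonPrefix S).length ≠ t (greatestCommonPrefix S).length := by
  by_contra! h
  have : (greatestCommonPrefix S).length + 1 ≤ (greatestCommonPrefix S).length := by
    refine le_length_greatestCommonPrefix hS fun s hs t ht i hi => ?_
    rcases Nat.lt_succ_iff_lt_or_eq.mp hi with h' | rfl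
    · exact agree_greatestCommonPrefix hS s hs t ht i h'
    · exact h s hs t ht
  omega

theorem greatestCommonPrefix_eq {u : List α} (hu : ∀ s ∈ S, seqPrefix s u.length = u)
    {s t : ℕ → α} (hs : s ∈ S) (ht : t ∈ S) (hst : s u.length ≠ t u.length) :
    greatestCommonPrefix S = u := by
  have hS : S.Nontrivial := ⟨s, hs, t, ht, fun h => hst (by rw [h])⟩
  have hlen : (greatestCommonPrefix S).length = u.length := by
    apply le_antisymm
    · by_contra! h
      exact hst (agree_greatestCommonPrefix hS s hs t ht _ h)
    · refine le_length_greatestCommonPrefix hS fun a ha b hb => ?_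
      exact seqPrefix_congr.mp ((hu a ha).trans (hu b hb).symm)
  rw [← seqPrefix_greatestCommonPrefix hS hs, hlen, hu s hs]

theorem greatestCommonPrefix_image_prependWord {n : ℕ} {S : Set (ℕ → Fin n)} (hS : S.Nontrivial)
    (u : List (Fin n)) :
    greatestCommonPrefix (prependWord u '' S) = u ++ greatestCommonPrefix S := by
  obtain ⟨s, hs, t, ht, hst⟩ := exists_ne_at_length_greatestCommonPrefix hS
  refine greatestCommonPrefix_eq ?_ (Set.mem_image_of_mem _ hs) (Set.mem_image_of_mem _ ht) ?_
  · rintro _ ⟨s, hs, rfl⟩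
    rw [List.length_append, seqPrefix_prependWord, seqPrefix_greatestCommonPrefix hS hs]
  · simpa using hst

theorem greatestCommonPrefix_univ {n : ℕ} (hn : 2 ≤ n) :
    greatestCommonPrefix (Set.univ : Set (ℕ → Fin n)) = [] :=
  greatestCommonPrefix_eq (s := fun _ => ⟨0, by omega⟩) (t := fun _ => ⟨1, by omega⟩)
    (by simp [seqPrefix_zero]) (Set.mem_univ _) (Set.mem_univ _) (by simp)

theorem univ_nontrivial {n : ℕ} (hn : 2 ≤ n) : (Set.univ : Set (ℕ → Fin n)).Nontrivial :=
  ⟨fun _ => ⟨0, by omega⟩, Set.mem_univ _, fun _ => ⟨1, by omega⟩, Set.mem_univ _,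
    fun h => by simpa using congrFun h 0⟩

end GreatestCommonPrefix

namespace Transducer

variable {n : ℕ}

/-! ### The maps induced by states -/

theorem outWord_append (T : Transducer n) (v w : List (Fin n)) (q : T.Q) :
    T.outWord (v ++ w) q = T.outWord v q ++ T.outWord w (T.run v q) := by
  induction v generalizing q with
  | nil => rfl
  | cons x v ih => simp [outWord, run, ih]

/-- Outputs of longer prefixes extend those of shorter ones, so any sufficiently long prefix can
replace the one chosen by `Nat.find`. -/
theorem stateMap_eq_getElem (T : Transducer n) (q : T.Q) (x : ℕ → Fin n) {i k : ℕ}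
    (h : i < (T.outWord (seqPrefix x k) q).length) :
    T.stateMap q x i = (T.outWord (seqPrefix x k) q)[i] := by
  classical
  have hex : ∃ k, i < (T.outWord (seqPrefix x k) q).length := ⟨k, h⟩
  have hle : Nat.find hex ≤ k := Nat.find_min' hex h
  obtain ⟨j, hj⟩ := Nat.exists_eq_add_of_le hle
  have h1 : T.stateMap q x i
      = (T.outWord (seqPrefix x (Nat.find hex)) q)[i]'(Nat.find_spec hex) := by
    simp only [stateMap, hex, dite_true]
  have hap : T.outWord (seqPrefix x k) q = T.outWord (seqPrefix x (Nat.find hex)) q ++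
      T.outWord (seqPrefix (fun i => x (Nat.find hex + i)) j)
        (T.run (seqPrefix x (Nat.find hex)) q) := by
    rw [← outWord_append, ← seqPrefix_add, ← hj]
  rw [h1, List.getElem_of_eq hap, List.getElem_append_left]

theorem stateMap_prependWord {T : Transducer n} (hT : T.Nondegenerate) (q : T.Q)
    (w : List (Fin n)) (y : ℕ → Fin n) :
    T.stateMap q (prependWord w y) = prependWord (T.outWord w q) (T.stateMap (T.run w q) y) := by
  funext i
  obtain ⟨k, hk⟩ := hT (T.run w q) y (i + 1)
  have hap : T.outWord (seqPrefix (prependWord w y) (w.length + k)) q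
      = T.outWord w q ++ T.outWord (seqPrefix y k) (T.run w q) := by
    rw [seqPrefix_prependWord, outWord_append]
  have hlt : i < (T.outWord (seqPrefix (prependWord w y) (w.length + k)) q).length := by
    rw [hap, List.length_append]
    omega
  rw [stateMap_eq_getElem T q _ hlt, List.getElem_of_eq hap]
  by_cases h : i < (T.outWord w q).length
  · rw [List.getElem_append_left h, prependWord_of_lt _ _ h]
  · obtain ⟨j, rfl⟩ := Nat.exists_eq_add_of_le (not_lt.mp h)
    rw [List.getElem_append_right (by omega), prependWord_add,
      stateMap_eq_getElem T _ y (k := k) (by omega)]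
    congr 1
    omega

theorem stateMap_cons {T : Transducer n} (hT : T.Nondegenerate) (q : T.Q)
    (a : Fin n) (y : ℕ → Fin n) :
    T.stateMap q (prependWord [a] y) = prependWord (T.out a q) (T.stateMap (T.trans a q) y) := by
  rw [stateMap_prependWord hT]
  simp [outWord, run]

/-- The maps induced by the states are determined by their recursion. -/
theorem eq_stateMap {T : Transducer n} (hT : T.Nondegenerate)
    (F : T.Q → (ℕ → Fin n) → ℕ → Fin n)
    (hF : ∀ a q y, F q (prependWord [a] y) = prependWord (T.out a q) (F (T.trans a q) y)) :
    F = T.stateMap := by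
  have key : ∀ w q y, F q (prependWord w y) = prependWord (T.outWord w q) (F (T.run w q) y) := by
    intro w
    induction w with
    | nil => intro q y; simp [outWord, run]
    | cons a w ih =>
      intro q y
      rw [show a :: w = [a] ++ w from rfl, prependWord_append, hF, ih, ← prependWord_append]
      rfl
  funext q x i
  obtain ⟨k, hk⟩ := hT q x (i + 1)
  rw [stateMap_eq_getElem T q x hk, ← prependWord_of_lt _ (F (T.run (seqPrefix x k) q)
    fun i => x (k + i)), ← key, prependWord_seqPrefix]

/-- The map induced by a state takes at least two values. -/
def Nonconstant (T : Transducer n) : Prop := ∀ q, (Set.range (T.stateMap q)).Nontrivial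

theorem Nonconstant.of_injective (hn : 2 ≤ n) {T : Transducer n}
    (h : ∀ q, Function.Injective (T.stateMap q)) : T.Nonconstant := by
  intro q
  rw [← Set.image_univ]
  exact (univ_nontrivial hn).image (h q)

theorem lam_nil (T : Transducer n) (q : T.Q) :
    T.Lam [] q = greatestCommonPrefix (Set.range (T.stateMap q)) := by
  simp [Lam]

theorem lam_eq {T : Transducer n} (hT : T.Nondegenerate) (hc : T.Nonconstant) (w : List (Fin n))
    (q : T.Q) : T.Lam w q = T.outWord w q ++ T.Lam [] (T.run w q) := by
  rw [lam_nil, ← greatestCommonPrefix_image_prependWord (hc _), Lam, ← Set.range_comp]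
  simp only [stateMap_prependWord hT, Function.comp_def]

theorem lam_nil_eq_nil_of_surjective (hn : 2 ≤ n) {T : Transducer n} {q : T.Q}
    (h : Function.Surjective (T.stateMap q)) : T.Lam [] q = [] := by
  rw [lam_nil, h.range_eq, greatestCommonPrefix_univ hn]

/-! ### Removing incomplete response -/

/-- A state, as a state of the transducer without incomplete response. -/
def reduced (T : Transducer n) (q : T.Q) : T.removeIncomplete.Q := q

/-- A state, as a representative of a state of the quotient. -/
def toClass (T : Transducer n) (q : T.Q) : T.identifyStates.Q := Quotient.mk T.omegaSetoid q

/-- A pair of states, as a state of the product. -/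
def pair (A B : Transducer n) (p : A.Q) (r : B.Q) : (A.fullProduct B).Q := (p, r)

/-- Both sides equal Λ(a, q). On the left this needs that Λ(ε, q) is a prefix of Λ(a, q), so that
dropping its length removes exactly that word. -/
theorem lam_nil_append_out {T : Transducer n} (hT : T.Nondegenerate) (hc : T.Nonconstant)
    (a : Fin n) (q : T.Q) :
    T.Lam [] q ++ T.removeIncomplete.out a (T.reduced q) = T.out a q ++ T.Lam [] (T.trans a q) := by
  have h1 : T.Lam [a] q = T.out a q ++ T.Lam [] (T.trans a q) := by
    rw [lam_eq hT hc]
    simp [outWord, run]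
  have hS : (Set.range fun x => T.stateMap q (prependWord [a] x)).Nontrivial := by
    have h2 : (Set.range fun x => T.stateMap q (prependWord [a] x))
        = prependWord (T.out a q) '' Set.range (T.stateMap (T.trans a q)) := by
      rw [← Set.range_comp]
      simp only [stateMap_cons hT, Function.comp_def]
    rw [h2]
    exact (hc _).image (prependWord_injective _)
  have hle : (T.Lam [] q).length ≤ (T.Lam [a] q).length := by
    refine le_length_greatestCommonPrefix hS ?_
    rintro _ ⟨s, rfl⟩ _ ⟨t, rfl⟩
    rw [lam_nil]
    exact agree_greatestCommonPrefix (hc q) _ ⟨_, rfl⟩ _ ⟨_, rfl⟩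
  obtain ⟨s, x, hx⟩ := hS.nonempty
  have e1 : seqPrefix s (T.Lam [a] q).length = T.Lam [a] q :=
    seqPrefix_greatestCommonPrefix hS ⟨x, hx⟩
  have e2 : seqPrefix s (T.Lam [] q).length = T.Lam [] q := by
    rw [lam_nil]
    exact seqPrefix_greatestCommonPrefix (hc q) ⟨_, hx⟩
  rw [← h1]
  change T.Lam [] q ++ (T.Lam [a] q).drop (T.Lam [] q).length = _
  obtain ⟨d, hd⟩ := Nat.exists_eq_add_of_le hle
  have : T.Lam [a] q = T.Lam [] q ++ seqPrefix (fun i => s ((T.Lam [] q).length + i)) d := by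
    conv_lhs => rw [← e1, hd, seqPrefix_add, e2]
  rw [this]
  simp

theorem lam_nil_append_outWord {T : Transducer n} (hT : T.Nondegenerate) (hc : T.Nonconstant)
    (w : List (Fin n)) (q : T.Q) :
    T.Lam [] q ++ T.removeIncomplete.outWord w (T.reduced q) = T.outWord w q ++ T.Lam [] (T.run w q) := by
  induction w generalizing q with
  | nil => simp [outWord, run]
  | cons a w ih =>
    have h := ih (T.trans a q)
    change T.Lam [] q ++ (T.removeIncomplete.out a (T.reduced q)
      ++ T.removeIncomplete.outWord w (T.reduced (T.trans a q))) = _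
    rw [← List.append_assoc, lam_nil_append_out hT hc, List.append_assoc, h]
    simp [outWord, run]

theorem Nondegenerate.removeIncomplete {T : Transducer n} (hT : T.Nondegenerate)
    (hc : T.Nonconstant) : T.removeIncomplete.Nondegenerate := by
  intro q x m
  obtain ⟨k, hk⟩ := hT q x (m + (T.Lam [] q).length)
  refine ⟨k, ?_⟩
  change m ≤ (T.removeIncomplete.outWord (seqPrefix x k) (T.reduced q)).length
  have h := congrArg List.length (lam_nil_append_outWord hT hc (seqPrefix x k) q)
  simp only [List.length_append] at h
  omega

/-- Deleting the first |Λ(ε, q)| letters from the values of each state map yields maps that satisfy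
the recursion of `removeIncomplete`; `eq_stateMap` then identifies them. -/
theorem stateMap_eq_prependWord_removeIncomplete {T : Transducer n} (hT : T.Nondegenerate)
    (hc : T.Nonconstant) (q : T.Q) (y : ℕ → Fin n) :
    T.stateMap q y = prependWord (T.Lam [] q) (T.removeIncomplete.stateMap (T.reduced q) y) := by
  have hpre : ∀ (q : T.Q) y, prependWord (T.Lam [] q)
      (fun i => T.stateMap q y ((T.Lam [] q).length + i)) = T.stateMap q y := by
    intro q y
    have h := prependWord_seqPrefix (T.stateMap q y) (T.Lam [] q).length
    rwa [show seqPrefix (T.stateMap q y) (T.Lam [] q).length = T.Lam [] q by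
      rw [lam_nil]; exact seqPrefix_greatestCommonPrefix (hc q) ⟨y, rfl⟩] at h
  have h := eq_stateMap (hT.removeIncomplete hc)
    (fun (q : T.Q) y i => T.stateMap q y ((T.Lam [] q).length + i)) ?_
  · rw [← h]
    exact (hpre q y).symm
  · intro a (q : T.Q) y
    apply prependWord_injective (T.Lam [] q)
    rw [hpre, ← prependWord_append]
    refine Eq.trans ?_ (congrArg (prependWord · _) (lam_nil_append_out hT hc a q).symm)
    rw [prependWord_append, stateMap_cons hT, ← hpre (T.trans a q)]
    rfl

theorem range_stateMap_eq {T : Transducer n} (hT : T.Nondegenerate) (hc : T.Nonconstant)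
    (q : T.Q) : Set.range (T.stateMap q)
      = prependWord (T.Lam [] q) '' Set.range (T.removeIncomplete.stateMap (T.reduced q)) := by
  rw [← Set.range_comp]
  congr 1
  funext y
  exact stateMap_eq_prependWord_removeIncomplete hT hc q y

theorem Nonconstant.removeIncomplete {T : Transducer n} (hT : T.Nondegenerate)
    (hc : T.Nonconstant) : T.removeIncomplete.Nonconstant := by
  intro (q : T.Q)
  have h := hc q
  rw [range_stateMap_eq hT hc] at h
  obtain ⟨_, ⟨s, hs, rfl⟩, _, ⟨t, ht, rfl⟩, hst⟩ := h
  exact ⟨s, hs, t, ht, fun e => hst (by rw [e])⟩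

theorem lam_nil_removeIncomplete {T : Transducer n} (hT : T.Nondegenerate)
    (hc : T.Nonconstant) (q : T.removeIncomplete.Q) : T.removeIncomplete.Lam [] q = [] := by
  have h := greatestCommonPrefix_image_prependWord ((hc.removeIncomplete hT) q) (T.Lam [] q)
  rw [← lam_nil] at h
  exact List.append_cancel_left
    ((h.symm.trans (congrArg _ (range_stateMap_eq hT hc q).symm)).trans
      ((lam_nil T q).symm.trans (List.append_nil _).symm))

/-! ### Identifying equivalent states -/

/-- Without incomplete response the output is Λ(a, q), which depends on the induced map only;
cancelling it determines the map of the successor. The quotient is thus independent of the chosen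
representatives. -/
theorem out_eq_of_stateMap_eq {A : Transducer n} (hA : A.Nondegenerate) (hc : A.Nonconstant)
    (hl : ∀ q, A.Lam [] q = []) {p q : A.Q} (h : A.stateMap p = A.stateMap q) (a : Fin n) :
    A.out a p = A.out a q ∧ A.stateMap (A.trans a p) = A.stateMap (A.trans a q) := by
  have h1 : ∀ q, A.Lam [a] q = A.out a q := fun q => by
    rw [lam_eq hA hc, hl]
    simp [outWord]
  have h2 : A.out a p = A.out a q := by
    rw [← h1, ← h1, Lam, Lam, h]
  refine ⟨h2, ?_⟩
  funext y
  apply prependWord_injective (A.out a p)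
  rw [← stateMap_cons hA, h, stateMap_cons hA, h2]

theorem identifyStates_out_trans {A : Transducer n} (hA : A.Nondegenerate) (hc : A.Nonconstant)
    (hl : ∀ q, A.Lam [] q = []) (a : Fin n) (q : A.Q) :
    A.identifyStates.out a (A.toClass q) = A.out a q ∧
    A.identifyStates.trans a (A.toClass q)
      = A.toClass (A.trans a q) := by
  have h : A.stateMap (Quotient.mk A.omegaSetoid q).out = A.stateMap q :=
    Quotient.exact (Quotient.out_eq (Quotient.mk A.omegaSetoid q))
  obtain ⟨h1, h2⟩ := out_eq_of_stateMap_eq hA hc hl h a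
  exact ⟨h1, Quotient.sound h2⟩

theorem identifyStates_outWord {A : Transducer n} (hA : A.Nondegenerate) (hc : A.Nonconstant)
    (hl : ∀ q, A.Lam [] q = []) (w : List (Fin n)) (q : A.Q) :
    A.identifyStates.outWord w (A.toClass q) = A.outWord w q := by
  induction w generalizing q with
  | nil => rfl
  | cons a w ih =>
    obtain ⟨h1, h2⟩ := identifyStates_out_trans hA hc hl a q
    simp only [outWord]
    rw [h1, h2, ih]

theorem identifyStates_run {A : Transducer n} (hA : A.Nondegenerate) (hc : A.Nonconstant)
    (hl : ∀ q, A.Lam [] q = []) (w : List (Fin n)) (q : A.Q) :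
    A.identifyStates.run w (A.toClass q)
      = A.toClass (A.run w q) := by
  induction w generalizing q with
  | nil => rfl
  | cons a w ih =>
    simp only [run]
    rw [(identifyStates_out_trans hA hc hl a q).2, ih]

theorem Nondegenerate.identifyStates {A : Transducer n} (hA : A.Nondegenerate)
    (hc : A.Nonconstant) (hl : ∀ q, A.Lam [] q = []) : A.identifyStates.Nondegenerate := by
  intro c x m
  induction c using Quotient.inductionOn with
  | h q =>
    obtain ⟨k, hk⟩ := hA q x m
    exact ⟨k, hk.trans_eq (congrArg _ (identifyStates_outWord hA hc hl _ q).symm)⟩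

theorem identifyStates_stateMap {A : Transducer n} (hA : A.Nondegenerate) (hc : A.Nonconstant)
    (hl : ∀ q, A.Lam [] q = []) (q : A.Q) :
    A.identifyStates.stateMap (A.toClass q) = A.stateMap q := by
  funext x i
  obtain ⟨k, hk⟩ := hA q x (i + 1)
  rw [stateMap_eq_getElem A q x hk, stateMap_eq_getElem _ _ x (k := k)
    (by rw [identifyStates_outWord hA hc hl]; omega)]
  exact List.getElem_of_eq (identifyStates_outWord hA hc hl _ _) _

/-! ### The minimal representative -/

theorem run_removeIncomplete (T : Transducer n) (w : List (Fin n)) (q : T.Q) :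
    T.removeIncomplete.run w (T.reduced q) = T.run w q := by
  induction w generalizing q with
  | nil => rfl
  | cons a w ih => exact ih (T.trans a q)

/-- The class of a state in the minimal representative. -/
noncomputable def toMinRep (T : Transducer n) (q : T.Q) : T.minRep.Q :=
  Quotient.mk T.removeIncomplete.omegaSetoid q

theorem toMinRep_surjective (T : Transducer n) : Function.Surjective T.toMinRep :=
  Quotient.mk_surjective (s := T.removeIncomplete.omegaSetoid)

section MinRep

variable {T : Transducer n}

theorem minRep_out (hT : T.Nondegenerate) (hc : T.Nonconstant) (a : Fin n) (q : T.Q) :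
    T.minRep.out a (T.toMinRep q) = T.removeIncomplete.out a (T.reduced q) :=
  (identifyStates_out_trans (hT.removeIncomplete hc) (hc.removeIncomplete hT)
    (lam_nil_removeIncomplete hT hc) a (T.reduced q)).1

theorem minRep_outWord (hT : T.Nondegenerate) (hc : T.Nonconstant) (w : List (Fin n)) (q : T.Q) :
    T.minRep.outWord w (T.toMinRep q) = T.removeIncomplete.outWord w (T.reduced q) :=
  identifyStates_outWord (hT.removeIncomplete hc) (hc.removeIncomplete hT)
    (lam_nil_removeIncomplete hT hc) w (T.reduced q)

theorem minRep_run (hT : T.Nondegenerate) (hc : T.Nonconstant) (w : List (Fin n)) (q : T.Q) :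
    T.minRep.run w (T.toMinRep q) = T.toMinRep (T.run w q) := by
  have h := identifyStates_run (hT.removeIncomplete hc) (hc.removeIncomplete hT)
    (lam_nil_removeIncomplete hT hc) w (T.reduced q)
  exact h.trans (congrArg _ (run_removeIncomplete T w q))

theorem minRep_stateMap (hT : T.Nondegenerate) (hc : T.Nonconstant) (q : T.Q) :
    T.minRep.stateMap (T.toMinRep q) = T.removeIncomplete.stateMap (T.reduced q) :=
  identifyStates_stateMap (hT.removeIncomplete hc) (hc.removeIncomplete hT)
    (lam_nil_removeIncomplete hT hc) (T.reduced q)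

theorem Nondegenerate.minRep (hT : T.Nondegenerate) (hc : T.Nonconstant) :
    T.minRep.Nondegenerate :=
  (hT.removeIncomplete hc).identifyStates (hc.removeIncomplete hT)
    (lam_nil_removeIncomplete hT hc)

theorem stateMap_eq_prependWord_minRep (hT : T.Nondegenerate) (hc : T.Nonconstant) (q : T.Q)
    (y : ℕ → Fin n) :
    T.stateMap q y = prependWord (T.Lam [] q) (T.minRep.stateMap (T.toMinRep q) y) := by
  rw [minRep_stateMap hT hc, stateMap_eq_prependWord_removeIncomplete hT hc]

theorem minRep_minimal (hT : T.Nondegenerate) (hc : T.Nonconstant) (hs : T.StronglyConnected) :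
    T.minRep.Minimal := by
  refine ⟨fun p q h => ?_, fun q => ?_, fun p q => ?_⟩
  · obtain ⟨p, rfl⟩ := T.toMinRep_surjective p
    obtain ⟨q, rfl⟩ := T.toMinRep_surjective q
    rw [minRep_stateMap hT hc, minRep_stateMap hT hc] at h
    exact Quotient.sound (s := T.removeIncomplete.omegaSetoid) h
  · obtain ⟨q, rfl⟩ := T.toMinRep_surjective q
    rw [lam_nil, minRep_stateMap hT hc, ← lam_nil, lam_nil_removeIncomplete hT hc]
  · obtain ⟨p, rfl⟩ := T.toMinRep_surjective p
    obtain ⟨q, rfl⟩ := T.toMinRep_surjective q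
    obtain ⟨w, hw⟩ := hs p q
    exact ⟨w, by rw [minRep_run hT hc, hw]⟩

theorem SyncAt.minRep (hT : T.Nondegenerate) (hc : T.Nonconstant) {k : ℕ} (h : T.SyncAt k) :
    T.minRep.SyncAt k := by
  intro w hw p q
  obtain ⟨p, rfl⟩ := T.toMinRep_surjective p
  obtain ⟨q, rfl⟩ := T.toMinRep_surjective q
  rw [minRep_run hT hc, minRep_run hT hc, h w hw p q]

theorem IsCore.minRep (hT : T.Nondegenerate) (hc : T.Nonconstant) (h : T.IsCore) :
    T.minRep.IsCore := by
  refine Set.eq_univ_of_forall fun q => ?_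
  obtain ⟨q, rfl⟩ := T.toMinRep_surjective q
  have hq : q ∈ T.coreStates := h ▸ Set.mem_univ q
  obtain ⟨k, hk, w, hw, hwq⟩ := hq
  refine ⟨k, hk.minRep hT hc, w, hw, fun p => ?_⟩
  obtain ⟨p, rfl⟩ := T.toMinRep_surjective p
  rw [minRep_run hT hc, hwq]

/-- The minimal representative lies in the monoid if the transducer satisfies all requirements
except minimality. -/
theorem minRep_memSO (hn : 2 ≤ n) [Finite T.Q] [Nonempty T.Q] (hT : T.Nondegenerate)
    (hs : T.StronglyConnected) (hsync : T.StronglySynchronizing) (hcore : T.IsCore)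
    (hinj : ∀ q, Function.Injective (T.stateMap q))
    (hclopen : ∀ q, IsClopen (Set.range (T.stateMap q))) : T.minRep.MemSO := by
  have hc := Nonconstant.of_injective hn hinj
  refine ⟨Finite.of_surjective _ T.toMinRep_surjective, Nonempty.map T.toMinRep inferInstance,
    hT.minRep hc, minRep_minimal hT hc hs, ?_, hcore.minRep hT hc, fun q => ?_, fun q => ?_⟩
  · obtain ⟨k, hk⟩ := hsync
    exact ⟨k, hk.minRep hT hc⟩
  · obtain ⟨q, rfl⟩ := T.toMinRep_surjective q
    intro x y hxy
    apply hinj q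
    rw [stateMap_eq_prependWord_minRep hT hc, hxy, ← stateMap_eq_prependWord_minRep hT hc]
  · obtain ⟨q, rfl⟩ := T.toMinRep_surjective q
    have h := (hclopen q).preimage (continuous_prependWord (T.Lam [] q))
    rw [range_stateMap_eq hT hc, Set.preimage_image_eq _ (prependWord_injective _),
      ← minRep_stateMap hT hc] at h
    exact h

end MinRep

/-- Minimal transducers are equal to their minimal representatives. -/
theorem Minimal.toMinRep_injective (hn : 2 ≤ n) {T : Transducer n} (hT : T.Nondegenerate)
    (hm : T.Minimal) (hinj : ∀ q, Function.Injective (T.stateMap q)) :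
    Function.Injective T.toMinRep := by
  intro p q h
  have hc := Nonconstant.of_injective hn hinj
  apply hm.1
  funext y
  rw [stateMap_eq_prependWord_minRep hT hc, stateMap_eq_prependWord_minRep hT hc, h, hm.2.1,
    hm.2.1]

/-! ### Products -/

theorem fullProduct_run (A B : Transducer n) (w : List (Fin n)) (p : A.Q) (r : B.Q) :
    (A.fullProduct B).run w (A.pair B p r) = A.pair B (A.run w p) (B.run (A.outWord w p) r) := by
  induction w generalizing p r with
  | nil => rfl
  | cons a w ih =>
    simp only [outWord, run_append]
    exact ih _ _

theorem fullProduct_outWord (A B : Transducer n) (w : List (Fin n)) (p : A.Q) (r : B.Q) :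
    (A.fullProduct B).outWord w (A.pair B p r) = B.outWord (A.outWord w p) r := by
  induction w generalizing p r with
  | nil => rfl
  | cons a w ih =>
    simp only [outWord, outWord_append]
    exact congrArg _ (ih _ _)

theorem outWord_seqPrefix (T : Transducer n) (q : T.Q) (x : ℕ → Fin n)
    (k : ℕ) : T.outWord (seqPrefix x k) q
      = seqPrefix (T.stateMap q x) (T.outWord (seqPrefix x k) q).length := by
  symm
  rw [seqPrefix_eq_iff]
  intro i hi
  exact stateMap_eq_getElem T q x hi

theorem outWord_length_mono (T : Transducer n) (q : T.Q) (x : ℕ → Fin n) {j k : ℕ} (h : j ≤ k) :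
    (T.outWord (seqPrefix x j) q).length ≤ (T.outWord (seqPrefix x k) q).length := by
  obtain ⟨d, rfl⟩ := Nat.exists_eq_add_of_le h
  rw [seqPrefix_add, outWord_append, List.length_append]
  omega

theorem Nondegenerate.fullProduct {A B : Transducer n} (hA : A.Nondegenerate)
    (hB : B.Nondegenerate) : (A.fullProduct B).Nondegenerate := by
  rintro ⟨p, r⟩ x m
  obtain ⟨k, hk⟩ := hB r (A.stateMap p x) m
  obtain ⟨l, hl⟩ := hA p x k
  refine ⟨l, ?_⟩
  change m ≤ ((A.fullProduct B).outWord _ (A.pair B p r)).length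
  rw [fullProduct_outWord, outWord_seqPrefix A]
  exact hk.trans (outWord_length_mono B r _ hl)

theorem fullProduct_stateMap {A B : Transducer n} (hA : A.Nondegenerate) (hB : B.Nondegenerate)
    (p : A.Q) (r : B.Q) (y : ℕ → Fin n) :
    (A.fullProduct B).stateMap (A.pair B p r) y = B.stateMap r (A.stateMap p y) := by
  have h := eq_stateMap (hA.fullProduct hB) (fun s y => B.stateMap s.2 (A.stateMap s.1 y)) ?_
  · exact (congrFun (congrFun h (A.pair B p r)) y).symm
  · intro a s y
    rw [stateMap_cons hA, stateMap_prependWord hB]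
    rfl

theorem core_outWord (T : Transducer n) (w : List (Fin n)) (q : T.core.Q) :
    T.core.outWord w q = T.outWord w q.1 := by
  induction w generalizing q with
  | nil => rfl
  | cons a w ih => exact congrArg _ (ih _)

theorem Nondegenerate.core {T : Transducer n} (hT : T.Nondegenerate) : T.core.Nondegenerate := by
  intro q x m
  obtain ⟨k, hk⟩ := hT q.1 x m
  exact ⟨k, by rwa [core_outWord]⟩

theorem core_stateMap {T : Transducer n} (hT : T.Nondegenerate) (q : T.core.Q) :
    T.core.stateMap q = T.stateMap q.1 := by
  funext x i
  obtain ⟨k, hk⟩ := hT q.1 x (i + 1)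
  rw [stateMap_eq_getElem T q.1 x hk, stateMap_eq_getElem _ _ x (k := k)
    (by rw [core_outWord]; omega)]
  exact List.getElem_of_eq (core_outWord _ _ _) _

theorem SyncAt.add {T : Transducer n} {k : ℕ} (h : T.SyncAt k) (j : ℕ) : T.SyncAt (j + k) := by
  intro w hw p q
  rw [← List.take_append_drop j w, run_append, run_append]
  exact h _ (by simp [hw]) _ _

/-- If `A` synchronizes at level `k` and, on reading `m` letters, always writes at least as many
letters as `B` needs for synchronizing, then the product synchronizes. -/
theorem SyncAt.fullProduct {A B : Transducer n} {k l m : ℕ} (hA : A.SyncAt k) (hB : B.SyncAt l)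
    (hm : ∀ w p, w.length = m → l ≤ (A.outWord w p).length) :
    (A.fullProduct B).SyncAt (k + m) := by
  rintro w hw ⟨p, r⟩ ⟨p', r'⟩
  change (A.fullProduct B).run w (A.pair B p r) = (A.fullProduct B).run w (A.pair B p' r')
  rw [← List.take_append_drop k w, run_append, run_append, fullProduct_run, fullProduct_run,
    hA (w.take k) (by simp [hw]) p p', fullProduct_run, fullProduct_run]
  have h := hm (w.drop k) (A.run (w.take k) p') (by simp [hw])
  obtain ⟨d, hd⟩ := Nat.exists_eq_add_of_le h
  exact congrArg _ (hB.add d _ (by omega) _ _)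

theorem run_mem_coreStates {T : Transducer n} {k : ℕ} (hk : T.SyncAt k) {w : List (Fin n)}
    (hw : w.length = k) (q : T.Q) : T.run w q ∈ T.coreStates :=
  ⟨k, hk, w, hw, fun p => hk w hw p q⟩

theorem exists_run_eq_of_mem_coreStates {T : Transducer n} {q : T.Q} (hq : q ∈ T.coreStates)
    (p : T.Q) : ∃ w, T.run w p = q := by
  obtain ⟨k, -, w, -, h⟩ := hq
  exact ⟨w, h p⟩

/-! ### Products equal to the identity -/

theorem identity_nondegenerate (n : ℕ) : (identity n).Nondegenerate := by
  intro q x m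
  refine ⟨m, ?_⟩
  have : ∀ w : List (Fin n), ((identity n).outWord w q).length = w.length := by
    intro w
    induction w with
    | nil => rfl
    | cons a w ih => simpa [outWord, identity] using ih
  simp [this]

theorem identity_stateMap (q : (identity n).Q) (y : ℕ → Fin n) :
    (identity n).stateMap q y = y := by
  rw [← eq_stateMap (identity_nondegenerate n) (fun _ y => y) fun _ _ _ => rfl]

/-- One pair of mutually inverse states suffices. Every core state is reached from that pair by a
word w, and if g is its map and o the output on w, then wy = o g(y) for all y. So g prepends a fixed
word, which the minimal representative removes. -/
theorem product_omegaEq_identity (hn : 2 ≤ n) {A B : Transducer n} (hA : A.Nondegenerate)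
    (hB : B.Nondegenerate) {k l m : ℕ} (hAs : A.SyncAt k) (hBs : B.SyncAt l)
    (hm : ∀ w p, w.length = m → l ≤ (A.outWord w p).length) (p : A.Q) (r : B.Q)
    (hid : ∀ y, B.stateMap r (A.stateMap p y) = y) :
    (A.product B).OmegaEq (identity n) := by
  have hP := hA.fullProduct hB
  have hW := hP.core
  have hS := hAs.fullProduct hBs hm
  have key : ∀ s : (A.fullProduct B).core.Q, ∃ c, ∀ y,
      (A.fullProduct B).core.stateMap s y = prependWord c y := by
    intro s
    obtain ⟨w, hw⟩ := exists_run_eq_of_mem_coreStates s.2 (A.pair B p r)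
    have h1 : ∀ y, prependWord w y = prependWord ((A.fullProduct B).outWord w (A.pair B p r))
        ((A.fullProduct B).stateMap s.1 y) := by
      intro y
      rw [← hw, ← stateMap_prependWord hP, fullProduct_stateMap hA hB, hid]
    set o := (A.fullProduct B).outWord w (A.pair B p r) with ho
    -- A longer `o` would prescribe the first letter of every `y`.
    have hle : o.length ≤ w.length := by
      by_contra! hlt
      have h2 := fun y => congrFun (h1 y) w.length
      have h3 : ∀ y : ℕ → Fin n, y 0 = o[w.length] := fun y => by
        rw [← prependWord_of_lt o _ hlt, ← h2]
        exact (prependWord_add w y 0).symm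
      have h4 := (h3 fun _ => ⟨0, by omega⟩).trans (h3 fun _ => ⟨1, by omega⟩).symm
      simp at h4
    refine ⟨w.drop o.length, fun y => ?_⟩
    rw [core_stateMap hP]
    funext i
    have h2 := congrFun (h1 y) (o.length + i)
    rw [prependWord_add] at h2
    rw [← h2, ← List.take_append_drop o.length w, prependWord_append]
    have h5 := prependWord_add (w.take o.length) (prependWord (w.drop o.length) y) i
    rw [List.length_take, min_eq_left hle] at h5
    rw [h5, List.take_append_drop]
  have hinj : ∀ s, Function.Injective ((A.fullProduct B).core.stateMap s) := by
    intro s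
    obtain ⟨c, hc⟩ := key s
    rw [show (A.fullProduct B).core.stateMap s = prependWord c from funext hc]
    exact prependWord_injective c
  have hc := Nonconstant.of_injective hn hinj
  have hmap : ∀ s, (A.product B).stateMap s = fun y => y := by
    intro s
    obtain ⟨s, rfl⟩ := (A.fullProduct B).core.toMinRep_surjective s
    obtain ⟨c, hs⟩ := key s
    have hL : (A.fullProduct B).core.Lam [] s = c := by
      rw [lam_nil, show (A.fullProduct B).core.stateMap s = prependWord c from funext hs,
        ← Set.image_univ, greatestCommonPrefix_image_prependWord (univ_nontrivial hn),
        greatestCommonPrefix_univ hn, List.append_nil]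
    funext y
    apply prependWord_injective c
    rw [← hs y, stateMap_eq_prependWord_minRep hW hc s y, hL]
    rfl
  -- All states of the product induce the identity, so any core state represents the only class; a
  -- word of synchronizing length supplies one.
  let s₀ : (A.fullProduct B).core.Q :=
    ⟨_, run_mem_coreStates hS (w := List.replicate (k + m) ⟨0, by omega⟩) (by simp) (A.pair B p r)⟩
  refine ⟨⟨fun _ => (), fun _ => (A.fullProduct B).core.toMinRep s₀, fun s => ?_, fun _ => rfl⟩,
    fun s => ?_⟩
  · obtain ⟨s, rfl⟩ := (A.fullProduct B).core.toMinRep_surjective s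
    refine Quotient.sound (s := (A.fullProduct B).core.removeIncomplete.omegaSetoid) ?_
    exact (minRep_stateMap hW hc s₀).symm.trans
      ((hmap _).trans ((hmap _).symm.trans (minRep_stateMap hW hc s)))
  · rw [hmap]
    funext y
    rw [identity_stateMap]

/-- The minimal representative differs from a core state only by the removed common prefix, which is
the word c. -/
theorem exists_comp_eq_of_product_omegaEq_identity (hn : 2 ≤ n) {A B : Transducer n}
    (hA : A.Nondegenerate) (hB : B.Nondegenerate)
    (hAi : ∀ p, Function.Injective (A.stateMap p)) (hBi : ∀ p, Function.Injective (B.stateMap p))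
    (h : (A.product B).OmegaEq (identity n)) {s : A.Q × B.Q}
    (hs : s ∈ (A.fullProduct B).coreStates) :
    ∃ c, ∀ y, B.stateMap s.2 (A.stateMap s.1 y) = prependWord c y := by
  have hP := hA.fullProduct hB
  have hc : (A.fullProduct B).core.Nonconstant := Nonconstant.of_injective hn fun s => by
    have : (A.fullProduct B).core.stateMap s = B.stateMap s.1.2 ∘ A.stateMap s.1.1 := by
      rw [core_stateMap hP]
      funext y
      exact fullProduct_stateMap hA hB _ _ _
    rw [this]
    exact (hBi _).comp (hAi _)
  obtain ⟨f, hf⟩ := h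
  let c : (A.fullProduct B).core.Q := ⟨s, hs⟩
  refine ⟨(A.fullProduct B).core.Lam [] c, fun y => ?_⟩
  have h1 := stateMap_eq_prependWord_minRep hP.core hc c y
  have h2 := hf ((A.fullProduct B).core.toMinRep c)
  rw [core_stateMap hP, show (A.fullProduct B).core.minRep.stateMap _ = _ from h2,
    identity_stateMap] at h1
  rw [← h1]
  exact (fullProduct_stateMap hA hB _ _ _).symm

/-! ### Left infinite paths of a synchronizing transducer -/

/-- The sequence without its first `m` entries. -/
def shiftSeq {α : Type} (m : ℕ) (x : ℕ → α) : ℕ → α := fun i => x (m + i)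

@[simp] theorem shiftSeq_zero {α : Type} (x : ℕ → α) : shiftSeq 0 x = x := by
  funext i
  exact congrArg x (Nat.zero_add i)

theorem shiftSeq_shiftSeq {α : Type} (l m : ℕ) (x : ℕ → α) :
    shiftSeq l (shiftSeq m x) = shiftSeq (m + l) x := by
  funext i
  simp [shiftSeq, add_assoc]

theorem seqPrefix_succ_shiftSeq {α : Type} (x : ℕ → α) (k : ℕ) :
    seqPrefix x (k + 1) = x 0 :: seqPrefix (shiftSeq 1 x) k := by
  rw [seqPrefix_succ]
  exact congrArg (fun y => x 0 :: seqPrefix y k) (funext fun i => congrArg x (Nat.add_comm i 1))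

theorem shiftSeq_prependWord {w : List (Fin n)} {m : ℕ} (hm : m ≤ w.length) (y : ℕ → Fin n) :
    shiftSeq m (prependWord w y) = prependWord (w.drop m) y := by
  funext i
  have h := prependWord_add (w.take m) (prependWord (w.drop m) y) i
  rw [← prependWord_append, List.take_append_drop, List.length_take, min_eq_left hm] at h
  exact h

theorem prependWord_shiftSeq_one (x : ℕ → Fin n) : prependWord [x 0] (shiftSeq 1 x) = x :=
  prependWord_seqPrefix x 1

/-! The notions for `T.reverse`, with vertices and edges typed in terms of `T`. -/

/-- Paths of the reverse. -/
def IsBackPath (T : Transducer n) (q : T.Q) (p : List (Fin n × T.Q)) : Prop :=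
  T.reverse.IsPath q p

/-- Ends of paths of the reverse. -/
def backEnd (T : Transducer n) (q : T.Q) (p : List (Fin n × T.Q)) : T.Q := T.reverse.endState q p

/-- Input labels of paths of the reverse. -/
def backLabel (T : Transducer n) (p : List (Fin n × T.Q)) : List (Fin n) := T.reverse.pathLabel p

/-- Outputs of paths of the reverse. -/
def backOut (T : Transducer n) (p : List (Fin n × T.Q)) : List (Fin n) := T.reverse.pathOut p

/-- Domains of states of the reverse. -/
def backDom (T : Transducer n) (q : T.Q) : Set (ℕ → Fin n) := T.reverse.dom q

/-- Infinite paths of the reverse. -/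
def backPaths (T : Transducer n) (q : T.Q) (w : List (Fin n)) : Set (ℕ → Fin n × T.Q) :=
  T.reverse.infinitePaths q w

/-- Greatest common prefixes of infinite paths of the reverse. -/
noncomputable def backL (T : Transducer n) (q : T.Q) (w : List (Fin n)) : List (Fin n × T.Q) :=
  T.reverse.L q w

theorem backL_nil (T : Transducer n) (q : T.Q) : T.backL q [] = [] := by
  unfold backL NDTransducer.L
  exact if_pos rfl

/-- The word of a state of the recovered transducer. -/
def recWord (T : Transducer n) (s : T.reverse.recover.Q) : List (Fin n) := s.1.1

/-- The vertex of a state of the recovered transducer. -/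
def recState (T : Transducer n) (s : T.reverse.recover.Q) : T.Q := s.1.2

theorem recover_ext {T : Transducer n} {s t : T.reverse.recover.Q}
    (h1 : T.recWord s = T.recWord t) (h2 : T.recState s = T.recState t) : s = t :=
  Subtype.ext (Prod.ext h1 h2)

/-- The end of the left infinite path `… x₂ x₁ x₀` in a transducer that synchronizes at level
`k`. -/
def pastState (T : Transducer n) (k : ℕ) (q₀ : T.Q) (x : ℕ → Fin n) : T.Q :=
  T.run (seqPrefix x k).reverse q₀

/-- The edges of the left infinite path `… x₂ x₁ x₀`. -/
def pastPath (T : Transducer n) (k : ℕ) (q₀ : T.Q) (x : ℕ → Fin n) : ℕ → Fin n × T.Q :=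
  fun i => (x i, T.pastState k q₀ (shiftSeq (i + 1) x))

section Past

variable {T : Transducer n} {k : ℕ}

/-- Both sides are ends of runs over the last k letters x_{k-1} … x₀; a different start does not
matter, by synchronization. -/
theorem trans_pastState (hk : T.SyncAt k) (q₀ : T.Q) (x : ℕ → Fin n) :
    T.trans (x 0) (T.pastState k q₀ (shiftSeq 1 x)) = T.pastState k q₀ x := by
  have h1 : T.run (seqPrefix x (k + 1)).reverse q₀
      = T.trans (x 0) (T.pastState k q₀ (shiftSeq 1 x)) := by
    rw [seqPrefix_succ_shiftSeq, List.reverse_cons, run_append]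
    rfl
  rw [← h1, seqPrefix_add, List.reverse_append, run_append]
  exact hk _ (by simp) _ _

theorem pastState_prependWord (hk : T.SyncAt k) (q₀ : T.Q) (w : List (Fin n)) (y : ℕ → Fin n) :
    T.pastState k q₀ (prependWord w y) = T.run w.reverse (T.pastState k q₀ y) := by
  induction w with
  | nil => simp [run]
  | cons a w ih =>
    rw [← trans_pastState hk, prependWord_cons_zero, shiftSeq_prependWord (by simp),
      List.drop_one, List.tail_cons, ih, List.reverse_cons, run_append]
    rfl

/-- A word that forces q is used as the recent past; being core provides it. -/
theorem exists_pastState_eq (hk : T.SyncAt k) (hcore : T.IsCore) (hn : 2 ≤ n) (q₀ q : T.Q) :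
    ∃ x, T.pastState k q₀ x = q := by
  obtain ⟨l, -, w, -, h⟩ : q ∈ T.coreStates := hcore ▸ Set.mem_univ q
  refine ⟨prependWord w.reverse fun _ => ⟨0, by omega⟩, ?_⟩
  rw [pastState_prependWord hk, List.reverse_reverse, h]

theorem backLabel_eq (T : Transducer n) (p : List (Fin n × T.Q)) :
    T.backLabel p = p.map Prod.fst := by
  induction p with
  | nil => rfl
  | cons e p ih =>
    rw [List.map_cons, ← ih]
    rfl

theorem map_fst_pastPath (T : Transducer n) (k : ℕ) (q₀ : T.Q) (x : ℕ → Fin n) (m : ℕ) :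
    (seqPrefix (T.pastPath k q₀ x) m).map Prod.fst = seqPrefix x m := by
  simp [seqPrefix, pastPath, Function.comp_def]

theorem seqPrefix_pastPath_succ (T : Transducer n) (k : ℕ) (q₀ : T.Q) (x : ℕ → Fin n) (m : ℕ) :
    seqPrefix (T.pastPath k q₀ x) (m + 1) = (x 0, T.pastState k q₀ (shiftSeq 1 x)) ::
      seqPrefix (T.pastPath k q₀ (shiftSeq 1 x)) m := by
  rw [seqPrefix_succ]
  congr 2
  funext i
  simp only [pastPath, shiftSeq_shiftSeq, shiftSeq, Nat.add_comm 1]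

theorem isPath_pastPath (hk : T.SyncAt k) (q₀ : T.Q) (x : ℕ → Fin n) (m : ℕ) :
    T.IsBackPath (T.pastState k q₀ x) (seqPrefix (T.pastPath k q₀ x) m) := by
  induction m generalizing x with
  | zero => trivial
  | succ m ih =>
    rw [seqPrefix_pastPath_succ]
    exact ⟨trans_pastState hk q₀ x, ih (shiftSeq 1 x)⟩

theorem backEnd_pastPath (T : Transducer n) (k : ℕ) (q₀ : T.Q) (x : ℕ → Fin n) (m : ℕ) :
    T.backEnd (T.pastState k q₀ x) (seqPrefix (T.pastPath k q₀ x) m)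
      = T.pastState k q₀ (shiftSeq m x) := by
  induction m generalizing x with
  | zero => rw [shiftSeq_zero]; rfl
  | succ m ih =>
    rw [seqPrefix_pastPath_succ]
    refine (ih (shiftSeq 1 x)).trans ?_
    rw [shiftSeq_shiftSeq, Nat.add_comm]

theorem run_backEnd (T : Transducer n) (p : List (Fin n × T.Q)) (q : T.Q)
    (hp : T.IsBackPath q p) :
    T.run (p.map Prod.fst).reverse (T.backEnd q p) = q := by
  induction p generalizing q with
  | nil => rfl
  | cons e p ih =>
    obtain ⟨he, hp⟩ := hp
    rw [List.map_cons, List.reverse_cons, run_append]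
    exact Eq.trans (congrArg (T.trans e.1) (ih _ hp)) he

/-- A path of the reverse from q, read backwards, is a run of T that ends at q. If its label starts
with the first k letters of x, these letters alone determine q. -/
theorem mem_backDom_iff (hk : T.SyncAt k) (q₀ : T.Q) {q : T.Q} {x : ℕ → Fin n} :
    x ∈ T.backDom q ↔ T.pastState k q₀ x = q := by
  constructor
  · intro h
    obtain ⟨p, hp, r, hr⟩ : ∃ p, T.IsBackPath q p ∧ seqPrefix x k <+: T.backLabel p := h k
    have h1 := run_backEnd T p q hp
    rw [← backLabel_eq, ← hr, List.reverse_append, run_append] at h1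
    rw [← h1]
    exact hk _ (by simp) _ _
  · rintro rfl m
    refine ⟨_, isPath_pastPath hk q₀ x m, ?_⟩
    change _ <+: T.backLabel _
    rw [backLabel_eq, map_fst_pastPath]

/-- Each vertex of an infinite path of the reverse is determined by the k labels that follow it on
that path, so the labels determine the whole path. -/
theorem backPaths_eq (hk : T.SyncAt k) (q₀ q : T.Q) (w : List (Fin n)) :
    T.backPaths q w
      = {s | ∃ x ∈ cone w, T.pastState k q₀ x = q ∧ s = T.pastPath k q₀ x} := by
  have hsrc : ∀ x i, T.reverse.src (T.pastPath k q₀ x i) = T.pastState k q₀ (shiftSeq i x) := by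
    intro x i
    rw [← trans_pastState hk, shiftSeq_shiftSeq]
    rfl
  ext s
  constructor
  · rintro ⟨h0, h1, m, hm⟩
    let x : ℕ → Fin n := fun i => (s i).1
    have hrun : ∀ j i, T.run (seqPrefix (shiftSeq (i + 1) x) j).reverse (s (i + j)).2
        = (s i).2 := by
      intro j
      induction j with
      | zero => intro i; rfl
      | succ j ih =>
        intro i
        rw [seqPrefix_succ_shiftSeq, List.reverse_cons, run_append, shiftSeq_shiftSeq,
          Nat.add_comm j 1, ← Nat.add_assoc, ih (i + 1)]
        exact (h1 i).symm
    have hs : s = T.pastPath k q₀ x := by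
      funext i
      refine Prod.ext rfl ?_
      rw [← hrun k i]
      exact hk _ (by simp) _ _
    refine ⟨x, ?_, ?_, hs⟩
    · obtain ⟨r, hr⟩ : w <+: T.backLabel (seqPrefix s m) := hm
      rw [hs, backLabel_eq, map_fst_pastPath] at hr
      have hle : w.length ≤ m := by
        have := congrArg List.length hr
        simp at this
        omega
      obtain ⟨d, rfl⟩ := Nat.exists_eq_add_of_le hle
      rw [seqPrefix_add] at hr
      exact (List.append_inj_left hr (by simp)).symm
    · rw [← h0, hs, hsrc, shiftSeq_zero]
  · rintro ⟨x, hx, rfl, rfl⟩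
    refine ⟨?_, fun i => (hsrc x (i + 1)).symm, w.length, ?_⟩
    · rw [hsrc, shiftSeq_zero]
    · have h : w <+: T.backLabel (seqPrefix (T.pastPath k q₀ x) w.length) := by
        rw [backLabel_eq, map_fst_pastPath, show seqPrefix x w.length = w from hx]
      exact h

theorem cone_subset_dom_iff (hk : T.SyncAt k) (q₀ : T.Q) {q : T.Q} {w : List (Fin n)} :
    cone w ⊆ T.backDom q ↔ ∀ y, T.pastState k q₀ (prependWord w y) = q := by
  constructor
  · exact fun h y => (mem_backDom_iff hk q₀).mp (h (prependWord_mem_cone w y))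
  · intro h x hx
    obtain ⟨y, rfl⟩ := mem_cone_iff.mp hx
    exact (mem_backDom_iff hk q₀).mpr (h y)

/-! ### Words that determine the end of every past -/

section Forced

variable {q₀ q : T.Q} {w : List (Fin n)}

theorem backL_eq (hk : T.SyncAt k) (hw : ∀ y, T.pastState k q₀ (prependWord w y) = q)
    (hne : w ≠ []) : T.backL q w
      = greatestCommonPrefix (Set.range fun y => T.pastPath k q₀ (prependWord w y)) := by
  rw [show T.backL q w = greatestCommonPrefix (T.backPaths q w) from if_neg hne,
    backPaths_eq hk q₀]
  congr 1
  ext s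
  constructor
  · rintro ⟨x, hx, -, rfl⟩
    obtain ⟨y, rfl⟩ := mem_cone_iff.mp hx
    exact ⟨y, rfl⟩
  · rintro ⟨y, rfl⟩
    exact ⟨_, prependWord_mem_cone w y, hw y, rfl⟩

theorem range_pastPath_nontrivial (hn : 2 ≤ n) (T : Transducer n) (k : ℕ) (q₀ : T.Q)
    (w : List (Fin n)) :
    (Set.range fun y => T.pastPath k q₀ (prependWord w y)).Nontrivial := by
  refine ⟨_, ⟨fun _ => ⟨0, by omega⟩, rfl⟩, _, ⟨fun _ => ⟨1, by omega⟩, rfl⟩, fun h => ?_⟩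
  have h1 := congrArg Prod.fst (congrFun h (w.length + 0))
  simp only [pastPath, prependWord_add] at h1
  simp at h1

theorem seqPrefix_pastPath_eq_backL (hn : 2 ≤ n) (hk : T.SyncAt k)
    (hw : ∀ y, T.pastState k q₀ (prependWord w y) = q) (y : ℕ → Fin n) :
    seqPrefix (T.pastPath k q₀ (prependWord w y)) (T.backL q w).length = T.backL q w := by
  by_cases hne : w = []
  · rw [hne, backL_nil]
    rfl
  · rw [backL_eq hk hw hne]
    exact seqPrefix_greatestCommonPrefix (range_pastPath_nontrivial hn T k q₀ w) ⟨y, rfl⟩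

/-- The label just beyond w is free, so no common prefix of the paths can reach it. -/
theorem length_backL_le (hn : 2 ≤ n) (hk : T.SyncAt k)
    (hw : ∀ y, T.pastState k q₀ (prependWord w y) = q) :
    (T.backL q w).length ≤ w.length := by
  by_contra! hlt
  have h : ∀ y y', T.pastPath k q₀ (prependWord w y) (w.length + 0)
      = T.pastPath k q₀ (prependWord w y') (w.length + 0) := fun y y' =>
    seqPrefix_congr.mp ((seqPrefix_pastPath_eq_backL hn hk hw y).trans
      (seqPrefix_pastPath_eq_backL hn hk hw y').symm) _ hlt
  have h1 := congrArg Prod.fst (h (fun _ => ⟨0, by omega⟩) (fun _ => ⟨1, by omega⟩))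
  simp only [pastPath, prependWord_add] at h1
  simp at h1

theorem exists_pastPath_ne (hn : 2 ≤ n) (hk : T.SyncAt k)
    (hw : ∀ y, T.pastState k q₀ (prependWord w y) = q) (hne : w ≠ []) :
    ∃ y y', T.pastPath k q₀ (prependWord w y) (T.backL q w).length
      ≠ T.pastPath k q₀ (prependWord w y') (T.backL q w).length := by
  obtain ⟨_, ⟨y, rfl⟩, _, ⟨y', rfl⟩, h⟩ :=
    exists_ne_at_length_greatestCommonPrefix (range_pastPath_nontrivial hn T k q₀ w)
  rw [← backL_eq hk hw hne] at h
  exact ⟨y, y', h⟩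

theorem pastPath_add (T : Transducer n) (k : ℕ) (q₀ : T.Q) (x : ℕ → Fin n) (m i : ℕ) :
    T.pastPath k q₀ x (m + i) = T.pastPath k q₀ (shiftSeq m x) i := by
  simp only [pastPath, shiftSeq_shiftSeq]
  rfl

theorem backEnd_backL (hn : 2 ≤ n) (hk : T.SyncAt k)
    (hw : ∀ y, T.pastState k q₀ (prependWord w y) = q) (y : ℕ → Fin n) :
    T.pastState k q₀ (prependWord (w.drop (T.backL q w).length) y)
      = T.backEnd q (T.backL q w) := by
  rw [← shiftSeq_prependWord (length_backL_le hn hk hw), ← backEnd_pastPath, hw,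
    seqPrefix_pastPath_eq_backL hn hk hw]

/-- The common prefix is maximal: an edge forced by the remaining word would prolong it. If no word
remains, the convention (ε)L = ε applies. Thus the pairs reached by `recover` are states, and its
`else` branch never occurs. -/
theorem drop_backL_mem_recStates (hn : 2 ≤ n) (hk : T.SyncAt k)
    (hw : ∀ y, T.pastState k q₀ (prependWord w y) = q) :
    (w.drop (T.backLabel (T.backL q w)).length, T.backEnd q (T.backL q w))
      ∈ T.reverse.recStates := by
  have hlen : (T.backLabel (T.backL q w)).length = (T.backL q w).length := by
    rw [backLabel_eq, List.length_map]
  rw [hlen]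
  have hv := backEnd_backL hn hk hw
  refine ⟨(cone_subset_dom_iff hk q₀).mpr hv, ?_⟩
  by_contra hne
  by_cases hd : w.drop (T.backL q w).length = []
  · apply hne
    change T.backL _ (w.drop _) = []
    rw [hd, backL_nil]
  · have hw0 : w ≠ [] := by
      rintro rfl
      simp at hd
    obtain ⟨y, y', h⟩ := exists_pastPath_ne hn hk hw hw0
    apply h
    have key : ∀ y, T.pastPath k q₀ (prependWord w y) (T.backL q w).length
        = T.pastPath k q₀ (prependWord (w.drop (T.backL q w).length) y) 0 := by
      intro y
      rw [← shiftSeq_prependWord (length_backL_le hn hk hw), ← pastPath_add, Nat.add_zero]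
    rw [key, key]
    exact seqPrefix_congr.mp ((seqPrefix_pastPath_eq_backL hn hk hv y).trans
      (seqPrefix_pastPath_eq_backL hn hk hv y').symm) 0 (List.length_pos_iff.mpr hne)

theorem exists_mem_recStates (hn : 2 ≤ n) (hk : T.SyncAt k) (q₀ : T.Q) :
    ∃ s, s ∈ T.reverse.recStates := by
  have hw : ∀ y, T.pastState k q₀ (prependWord (List.replicate k (⟨0, by omega⟩ : Fin n)) y)
      = T.run (List.replicate k (⟨0, by omega⟩ : Fin n)) q₀ := by
    intro y
    rw [pastState_prependWord hk, List.reverse_replicate]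
    exact hk _ (by simp) _ _
  exact ⟨_, drop_backL_mem_recStates hn hk hw⟩

end Forced

/-! ### The recovered transducer -/

theorem forced_of_mem_recStates (hk : T.SyncAt k) (q₀ : T.Q) (s : T.reverse.recover.Q)
    (y : ℕ → Fin n) : T.pastState k q₀ (prependWord (T.recWord s) y) = (T.recState s) :=
  (cone_subset_dom_iff hk q₀).mp s.2.1 y

theorem forced_append (hk : T.SyncAt k) (q₀ : T.Q) (s : T.reverse.recover.Q) (a : Fin n)
    (y : ℕ → Fin n) : T.pastState k q₀ (prependWord (T.recWord s ++ [a]) y) = (T.recState s) := by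
  rw [prependWord_append]
  exact forced_of_mem_recStates hk q₀ s _

/-- In a longer word the letters after the first number at least k and force the vertex behind the
first edge. That edge would then be common to all paths, contrary to (w)L_q = ε. -/
theorem length_recWord_le (hn : 2 ≤ n) (hk : T.SyncAt k) (s : T.reverse.recover.Q) :
    (T.recWord s).length ≤ k := by
  by_contra! hlt
  have hf := forced_of_mem_recStates hk (T.recState s) s
  have hL : T.backL (T.recState s) (T.recWord s) = [] := s.2.2
  obtain ⟨a, w, haw⟩ : ∃ a w, (T.recWord s) = a :: w := by
    cases h : (T.recWord s) with
    | nil => simp [h] at hlt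
    | cons a w => exact ⟨a, w, rfl⟩
  obtain ⟨y, y', h⟩ := exists_pastPath_ne hn hk hf (by simp [haw])
  apply h
  rw [hL]
  refine Prod.ext ?_ ?_
  · simp [pastPath, haw]
  · have : ∀ y, T.pastState k (T.recState s) (shiftSeq (0 + 1) (prependWord (T.recWord s) y))
        = T.run w.reverse (T.pastState k (T.recState s) y) := by
      intro y
      rw [haw, shiftSeq_prependWord (by simp)]
      exact pastState_prependWord hk _ w y
    simp only [pastPath, List.length_nil, this]
    obtain ⟨d, hd⟩ := Nat.exists_eq_add_of_le hlt
    refine hk.add d _ ?_ _ _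
    rw [haw, List.length_cons] at hd
    rw [List.length_reverse]
    omega

theorem recWord_trans (hn : 2 ≤ n) (hk : T.SyncAt k) (a : Fin n) (s : T.reverse.recover.Q) :
    T.recWord (T.reverse.recover.trans a s)
      = (T.recWord s ++ [a]).drop (T.backL (T.recState s) (T.recWord s ++ [a])).length := by
  have h := drop_backL_mem_recStates hn hk (forced_append hk (T.recState s) s a)
  have h1 : T.reverse.recover.trans a s = ⟨_, h⟩ := dif_pos h
  rw [h1]
  change (T.recWord s ++ [a]).drop (T.backLabel _).length = _
  rw [backLabel_eq, List.length_map]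

/-- The output along the left infinite path `… x₂ x₁ x₀` of a synchronous transducer with output
letters `lam`. -/
def pastOut (T : Transducer n) (k : ℕ) (q₀ : T.Q) (lam : Fin n → T.Q → Fin n) (x : ℕ → Fin n) :
    ℕ → Fin n :=
  fun i => lam (x i) (T.pastState k q₀ (shiftSeq (i + 1) x))

/-! ### The recovered transducer of a synchronous transducer -/

section Synchronous

variable {lam : Fin n → T.Q → Fin n}

theorem shiftSeq_pastOut (T : Transducer n) (k : ℕ) (q₀ : T.Q) (lam : Fin n → T.Q → Fin n)
    (m : ℕ) (x : ℕ → Fin n) :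
    shiftSeq m (T.pastOut k q₀ lam x) = T.pastOut k q₀ lam (shiftSeq m x) := by
  funext i
  simp only [pastOut, shiftSeq_shiftSeq]
  rfl

theorem pastOut_cons (T : Transducer n) (k : ℕ) (q₀ : T.Q) (lam : Fin n → T.Q → Fin n)
    (a : Fin n) (x : ℕ → Fin n) : T.pastOut k q₀ lam (prependWord [a] x)
      = prependWord [lam a (T.pastState k q₀ x)] (T.pastOut k q₀ lam x) := by
  have h : shiftSeq 1 (prependWord [a] x) = x := by
    rw [shiftSeq_prependWord (by simp)]
    simp
  rw [← prependWord_shiftSeq_one (T.pastOut k q₀ lam _), shiftSeq_pastOut, h]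
  simp only [pastOut, h, Nat.zero_add, prependWord_cons_zero]

theorem backOut_eq (hlam : ∀ a p, T.out a p = [lam a p]) (p : List (Fin n × T.Q)) :
    T.backOut p = p.map fun e => lam e.1 e.2 := by
  induction p with
  | nil => rfl
  | cons e p ih =>
    rw [List.map_cons, ← ih]
    change (T.out e.1 e.2).reverse ++ _ = _
    rw [hlam]
    rfl

theorem recover_out (hn : 2 ≤ n) (hk : T.SyncAt k) (q₀ : T.Q)
    (hlam : ∀ a p, T.out a p = [lam a p]) (a : Fin n) (s : T.reverse.recover.Q) (y : ℕ → Fin n) :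
    T.reverse.recover.out a s = seqPrefix (T.pastOut k q₀ lam (prependWord (T.recWord s ++ [a]) y))
      (T.backL (T.recState s) (T.recWord s ++ [a])).length := by
  change T.backOut (T.backL (T.recState s) (T.recWord s ++ [a])) = _
  rw [backOut_eq hlam]
  conv_lhs => rw [← seqPrefix_pastPath_eq_backL hn hk (forced_append hk q₀ s a) y]
  simp [seqPrefix, pastPath, pastOut, Function.comp_def]

/-- Letters are conserved: each letter read has either been converted into an output letter or is
still stored in the word of the state. Since stored words have at most k letters, non-degeneracy
follows. -/
theorem length_recover_outWord (hn : 2 ≤ n) (hk : T.SyncAt k)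
    (hlam : ∀ a p, T.out a p = [lam a p]) (v : List (Fin n)) (s : T.reverse.recover.Q) :
    (T.reverse.recover.outWord v s).length + (T.recWord (T.reverse.recover.run v s)).length
      = (T.recWord s).length + v.length := by
  induction v generalizing s with
  | nil => simp [outWord, run]
  | cons a v ih =>
    have h1 := ih (T.reverse.recover.trans a s)
    have h2 := length_backL_le hn hk (forced_append hk (T.recState s) s a)
    rw [recWord_trans hn hk, List.length_drop] at h1
    rw [outWord, run, List.length_append,
      recover_out hn hk (T.recState s) hlam a s fun _ => a, length_seqPrefix]
    simp only [List.length_append, List.length_cons, List.length_nil] at h1 h2 ⊢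
    omega

theorem recover_nondegenerate (hn : 2 ≤ n) (hk : T.SyncAt k)
    (hlam : ∀ a p, T.out a p = [lam a p]) : T.reverse.recover.Nondegenerate := by
  intro s x m
  refine ⟨m + k, ?_⟩
  have h1 := length_recover_outWord hn hk hlam (seqPrefix x (m + k)) s
  have h2 := length_recWord_le hn hk (T.reverse.recover.run (seqPrefix x (m + k)) s)
  rw [length_seqPrefix] at h1
  omega

/-- The right-hand sides satisfy the recursion of the recovered transducer: a step writes the
outputs along the forced path and deletes its labels, and `pastOut` commutes with that deletion. -/
theorem recover_stateMap (hn : 2 ≤ n) (hk : T.SyncAt k) (q₀ : T.Q)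
    (hlam : ∀ a p, T.out a p = [lam a p]) (s : T.reverse.recover.Q) (y : ℕ → Fin n) :
    T.reverse.recover.stateMap s y = T.pastOut k q₀ lam (prependWord (T.recWord s) y) := by
  rw [← eq_stateMap (recover_nondegenerate hn hk hlam)
    (fun s y => T.pastOut k q₀ lam (prependWord (T.recWord s) y))]
  intro a s y
  rw [← prependWord_append, recWord_trans hn hk, recover_out hn hk q₀ hlam a s y,
    ← shiftSeq_prependWord (length_backL_le hn hk (forced_append hk q₀ s a)), ← shiftSeq_pastOut]
  exact (prependWord_seqPrefix _ _).symm

theorem recover_finite [Finite T.Q] (hn : 2 ≤ n) (hk : T.SyncAt k) :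
    Finite T.reverse.recover.Q := by
  have h : {w : List (Fin n) | w.length ≤ k}.Finite := List.finite_length_le (Fin n) k
  have := h.to_subtype
  exact Finite.of_injective (β := {w : List (Fin n) | w.length ≤ k} × T.Q)
    (fun s => (⟨T.recWord s, length_recWord_le hn hk s⟩, T.recState s))
    fun s t h => by
      obtain ⟨h1, h2⟩ := Prod.mk.inj h
      exact recover_ext (congrArg Subtype.val h1) h2

end Synchronous
end Past

/-! ### Synchronous elements with invertible states -/

theorem Synchronous.exists_letter {T : Transducer n} (h : T.Synchronous) :
    ∃ lam : Fin n → T.Q → Fin n, ∀ a p, T.out a p = [lam a p] := by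
  choose lam hlam using fun a p => List.length_eq_one_iff.mp (h a p)
  exact ⟨lam, hlam⟩

theorem length_outWord_of_synchronous {T : Transducer n} (h : T.Synchronous) (w : List (Fin n))
    (q : T.Q) : (T.outWord w q).length = w.length := by
  induction w generalizing q with
  | nil => rfl
  | cons a w ih =>
    rw [outWord, List.length_append, h, ih, List.length_cons, Nat.add_comm]

theorem Synchronous.nondegenerate {T : Transducer n} (h : T.Synchronous) : T.Nondegenerate :=
  fun q x m => ⟨m, by rw [length_outWord_of_synchronous h, length_seqPrefix]⟩

theorem nondegenerate_of_letter {T : Transducer n} {lam : Fin n → T.Q → Fin n}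
    (hlam : ∀ a p, T.out a p = [lam a p]) : T.Nondegenerate :=
  Synchronous.nondegenerate fun a p => by rw [hlam]; rfl

theorem letter_surjective {T : Transducer n} {lam : Fin n → T.Q → Fin n}
    (hlam : ∀ a p, T.out a p = [lam a p]) (hsurj : ∀ q, Function.Surjective (T.stateMap q))
    (p : T.Q) (b : Fin n) : ∃ a, lam a p = b := by
  obtain ⟨x, hx⟩ := hsurj p fun _ => b
  refine ⟨x 0, ?_⟩
  rw [← prependWord_shiftSeq_one x, stateMap_cons (nondegenerate_of_letter hlam), hlam] at hx
  simpa using congrFun hx 0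

theorem letter_injective {T : Transducer n} {lam : Fin n → T.Q → Fin n}
    (hlam : ∀ a p, T.out a p = [lam a p]) (hsurj : ∀ q, Function.Surjective (T.stateMap q))
    (p : T.Q) : Function.Injective fun a => lam a p :=
  Finite.injective_iff_surjective.mpr (letter_surjective hlam hsurj p)

/-- Words of outputs can be prescribed along left infinite paths. -/
theorem exists_pastOut_prependWord {T : Transducer n} {lam : Fin n → T.Q → Fin n}
    (hlam : ∀ a p, T.out a p = [lam a p]) (hsurj : ∀ q, Function.Surjective (T.stateMap q))
    (k : ℕ) (q₀ : T.Q) (u : List (Fin n)) (t : ℕ → Fin n) :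
    ∃ v : List (Fin n), v.length = u.length ∧
      T.pastOut k q₀ lam (prependWord v t) = prependWord u (T.pastOut k q₀ lam t) := by
  induction u with
  | nil => exact ⟨[], rfl, by simp⟩
  | cons b u ih =>
    obtain ⟨v, hv, h⟩ := ih
    obtain ⟨a, ha⟩ := letter_surjective hlam hsurj (T.pastState k q₀ (prependWord v t)) b
    refine ⟨a :: v, by simp [hv], ?_⟩
    rw [show a :: v = [a] ++ v from rfl, prependWord_append, pastOut_cons, ha, h,
      ← prependWord_append]
    rfl

/-- In an invertible synchronous transducer, long words of outputs force the state. -/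
theorem MemO.exists_output_sync (hn : 2 ≤ n) {T : Transducer n} (hO : T.MemO)
    (hsyn : T.Synchronous) (hsurj : ∀ q, Function.Surjective (T.stateMap q)) :
    ∃ l, ∀ v v' p p', v.length = l → v'.length = l → T.outWord v p = T.outWord v' p' →
      T.run v p = T.run v' p' := by
  obtain ⟨hT, U, hU, hTU, -⟩ := hO
  obtain ⟨l, hl⟩ := hU.stronglySynchronizing
  have hTn := hT.nondegenerate
  have hUn := hU.nondegenerate
  have hinv : ∀ p, ∃ r, ∀ y, U.stateMap r (T.stateMap p y) = y := by
    intro p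
    obtain ⟨k, hk, w, hw, hp⟩ : p ∈ T.coreStates := hT.isCore ▸ Set.mem_univ p
    have hS := hk.fullProduct hl (m := l) fun v q hv => by
      rw [length_outWord_of_synchronous hsyn, hv]
    obtain ⟨r₀⟩ := hU.nonempty
    have hn0 : 0 < n := by omega
    -- The word `w` forces `p`; the padding by l letters raises the length to k + l, the level at
    -- which the product synchronizes.
    have hmem := run_mem_coreStates hS
      (w := List.replicate l (⟨0, hn0⟩ : Fin n) ++ w) (by simp [hw, Nat.add_comm])
      (T.pair U p r₀)
    rw [fullProduct_run, run_append, hp] at hmem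
    set r := U.run (T.outWord (List.replicate l (⟨0, hn0⟩ : Fin n) ++ w) p) r₀
    obtain ⟨c, hc⟩ := exists_comp_eq_of_product_omegaEq_identity hn hTn hUn hT.injective
      hU.injective hTU hmem
    have hc' : U.stateMap r ∘ T.stateMap p = prependWord c := funext hc
    -- As `T.stateMap p` is onto, the image of the state `r` is the set of all words with prefix
    -- `c`. Since `r` has no incomplete response, `c` is empty.
    have hr := hU.minimal.2.1 r
    rw [lam_nil, ← (hsurj p).range_comp, hc', ← Set.image_univ,
      greatestCommonPrefix_image_prependWord (univ_nontrivial hn), greatestCommonPrefix_univ hn,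
      List.append_nil] at hr
    refine ⟨r, fun y => ?_⟩
    rw [← Function.comp_apply (f := U.stateMap r), hc', hr, prependWord_nil]
  choose r hr using hinv
  -- Inversion persists along runs: comparing greatest common prefixes shows that U, fed with the
  -- output of T on `v`, writes back exactly `v`.
  have key : ∀ v p, v.length = l → ∀ y,
      U.stateMap (U.run (T.outWord v p) (r p)) (T.stateMap (T.run v p) y) = y := by
    intro v p hv
    have h1 : ∀ y, prependWord (U.outWord (T.outWord v p) (r p))
        (U.stateMap (U.run (T.outWord v p) (r p)) (T.stateMap (T.run v p) y))
          = prependWord v y := by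
      intro y
      rw [← stateMap_prependWord hUn, ← stateMap_prependWord hTn, hr]
    have h2 : prependWord (U.outWord (T.outWord v p) (r p)) ''
        Set.range (U.stateMap (U.run (T.outWord v p) (r p))) = Set.range (prependWord v) := by
      rw [← (hsurj (T.run v p)).range_comp, ← Set.range_comp]
      exact congrArg Set.range (funext h1)
    have h3 := congrArg greatestCommonPrefix h2
    rw [greatestCommonPrefix_image_prependWord
      (Nonconstant.of_injective hn hU.injective _), ← lam_nil, hU.minimal.2.1, ← Set.image_univ,
      greatestCommonPrefix_image_prependWord (univ_nontrivial hn), greatestCommonPrefix_univ hn,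
      List.append_nil, List.append_nil] at h3
    intro y
    apply prependWord_injective v
    rw [← h1 y, h3]
  refine ⟨l, fun v v' p p' hv hv' hout => ?_⟩
  apply hT.minimal.1
  -- U synchronizes on the common output, so a single state of U inverts both states of T; these
  -- then induce the same map.
  have hρ : U.run (T.outWord v p) (r p) = U.run (T.outWord v' p') (r p') := by
    rw [← hout]
    exact hl _ (by rw [length_outWord_of_synchronous hsyn, hv]) _ _
  have h1 := key v p hv
  have h2 := key v' p' hv'
  rw [← hρ] at h2
  funext y
  exact hU.injective _ ((h1 y).trans (h2 y).symm)

/-- This translates outputs of forward runs into blocks of `pastOut`, so that synchronization on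
outputs applies to pasts. -/
theorem outWord_pastState {T : Transducer n} {k : ℕ} (hk : T.SyncAt k) (q₀ : T.Q)
    {lam : Fin n → T.Q → Fin n} (hlam : ∀ a p, T.out a p = [lam a p]) (w : List (Fin n))
    (y : ℕ → Fin n) : T.outWord w.reverse (T.pastState k q₀ y)
      = (seqPrefix (T.pastOut k q₀ lam (prependWord w y)) w.length).reverse := by
  induction w with
  | nil => rfl
  | cons a w ih =>
    rw [List.reverse_cons, outWord_append, ih, ← pastState_prependWord hk,
      show a :: w = [a] ++ w from rfl, prependWord_append, pastOut_cons,
      show ([a] ++ w).length = [lam a (T.pastState k q₀ (prependWord w y))].length + w.length by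
        simp [Nat.add_comm], seqPrefix_prependWord]
    simp [outWord, hlam]

/-- The first l output letters determine the end of the path. Applied to all shifts, this gives
equal states along paths with equal outputs, and in a given state the output letter determines the
input letter. -/
theorem pastOut_injective {T : Transducer n} {k l : ℕ} (hk : T.SyncAt k) (q₀ : T.Q)
    {lam : Fin n → T.Q → Fin n} (hlam : ∀ a p, T.out a p = [lam a p])
    (hsurj : ∀ q, Function.Surjective (T.stateMap q))
    (hl : ∀ v v' p p', v.length = l → v'.length = l → T.outWord v p = T.outWord v' p' →
      T.run v p = T.run v' p') : Function.Injective (T.pastOut k q₀ lam) := by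
  have hst : ∀ x x', T.pastOut k q₀ lam x = T.pastOut k q₀ lam x' →
      T.pastState k q₀ x = T.pastState k q₀ x' := by
    intro x x' h
    have hx : ∀ x : ℕ → Fin n, prependWord (seqPrefix x l) (shiftSeq l x) = x :=
      fun x => prependWord_seqPrefix x l
    rw [← hx x, ← hx x', pastState_prependWord hk, pastState_prependWord hk]
    apply hl _ _ _ _ (by simp) (by simp)
    rw [outWord_pastState hk q₀ hlam, outWord_pastState hk q₀ hlam, hx, hx, h]
    simp
  intro x x' h
  funext i
  have h1 : T.pastOut k q₀ lam (shiftSeq (i + 1) x) = T.pastOut k q₀ lam (shiftSeq (i + 1) x') := by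
    rw [← shiftSeq_pastOut, ← shiftSeq_pastOut, h]
  have h2 := congrFun h i
  simp only [pastOut, hst _ _ h1] at h2
  exact letter_injective hlam hsurj _ h2

/-- If a synchronous invertible transducer has a synchronous recovered reverse with surjective
states, then all its states induce the same map. -/
theorem subsingleton_of_revRec (hn : 2 ≤ n) {T : Transducer n} (hT : T.MemH)
    (hR : T.revRec.MemH) : Subsingleton T.Q := by
  obtain ⟨hO, hsyn, hhomeo⟩ := hT
  obtain ⟨-, hRsyn, hRhomeo⟩ := hR
  have hsurj := fun q => (hhomeo q).surjective
  obtain ⟨lam, hlam⟩ := hsyn.exists_letter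
  obtain ⟨k, hk⟩ := hO.1.stronglySynchronizing
  obtain ⟨q₀⟩ := hO.1.nonempty
  obtain ⟨l, hl⟩ := hO.exists_output_sync hn hsyn hsurj
  have hinj := pastOut_injective hk q₀ hlam hsurj hl
  have hRn := recover_nondegenerate hn hk hlam
  have hRc : T.reverse.recover.Nonconstant := Nonconstant.of_injective hn fun s x y h => by
    rw [recover_stateMap hn hk q₀ hlam, recover_stateMap hn hk q₀ hlam] at h
    exact prependWord_injective _ (hinj h)
  obtain ⟨s, hs⟩ := exists_mem_recStates hn hk q₀
  let s : T.reverse.recover.Q := ⟨s, hs⟩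
  set w := T.recWord s
  set u := T.reverse.recover.Lam [] s
  let c : T.revRec.Q := T.reverse.recover.toMinRep s
  have hrep : ∀ y, T.pastOut k q₀ lam (prependWord w y)
      = prependWord u (T.revRec.stateMap c y) := fun y => by
    rw [← recover_stateMap hn hk q₀ hlam]
    exact stateMap_eq_prependWord_minRep hRn hRc s y
  -- Otherwise let `b` differ from the letter of `w` at position |u|. Some `v` of length |u| has F(v
  -- b b …) = u F(b b …), which is a value F(w y) because the state `c` is onto. Injectivity of F
  -- contradicts the choice of `b`.
  have hle : w.length ≤ u.length := by
    by_contra! hlt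
    obtain ⟨b, hb⟩ : ∃ b : Fin n, b ≠ w[u.length] := by
      have : Nontrivial (Fin n) := Fin.nontrivial_iff_two_le.mpr hn
      exact exists_ne _
    obtain ⟨v, hv, h⟩ := exists_pastOut_prependWord hlam hsurj k q₀ u fun _ => b
    obtain ⟨y, hy⟩ := (hRhomeo c).surjective (T.pastOut k q₀ lam fun _ => b)
    rw [← hy, ← hrep] at h
    have h1 := congrFun (hinj h) (v.length + 0)
    rw [prependWord_add, prependWord_of_lt _ _ (by omega)] at h1
    apply hb
    simpa [hv] using h1
  obtain ⟨d, hd⟩ := Nat.exists_eq_add_of_le hle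
  obtain ⟨mu, hmu⟩ := hRsyn.exists_letter
  have hlam' : ∀ a p, lam a p = mu a c := by
    intro a p
    obtain ⟨t, ht⟩ := exists_pastState_eq hk hO.1.isCore hn q₀ p
    -- In y = a a^d t the letter `a` stands at position 0, which decides the first output of `c`,
    -- and at position d, where T reads it in the state `p`.
    have h1 := congrFun (hrep (prependWord [a] (prependWord (List.replicate d a) t)))
      (u.length + 0)
    rw [prependWord_add, stateMap_cons (nondegenerate_of_letter hmu), hmu,
      prependWord_cons_zero] at h1
    rw [← h1]
    have h2 : prependWord w (prependWord [a] (prependWord (List.replicate d a) t))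
        = prependWord (w ++ List.replicate d a) (prependWord [a] t) := by
      rw [← prependWord_append, ← prependWord_append, ← prependWord_append]
      congr 1
      rw [List.append_assoc, List.append_assoc, List.singleton_append, ← List.replicate_succ,
        List.replicate_succ']
    have h3 : u.length = (w ++ List.replicate d a).length := by simp [hd]
    have h4 : ∀ x, T.pastOut k q₀ lam x (u.length + 0)
        = T.pastOut k q₀ lam (shiftSeq u.length x) 0 := fun x =>
      congrFun (shiftSeq_pastOut T k q₀ lam u.length x) 0
    rw [h4, h2, h3, shiftSeq_prependWord le_rfl, List.drop_length, prependWord_nil, pastOut_cons,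
      prependWord_cons_zero, ht]
  refine ⟨fun p q => hO.1.minimal.1 p q ?_⟩
  have h : (fun (_ : T.Q) (y : ℕ → Fin n) (i : ℕ) => mu (y i) c) = T.stateMap := by
    refine eq_stateMap hO.1.nondegenerate _ fun a q y => ?_
    rw [hlam, hlam' a q]
    funext i
    cases i <;> simp
  rw [← h]

/-! ### Transducers with one state -/

/-- The one state transducer that applies a permutation to each letter. -/
def ofPerm (σ : Equiv.Perm (Fin n)) : Transducer n where
  Q := Unit
  trans _ q := q
  out x _ := [σ x]

theorem stateMap_of_subsingleton {T : Transducer n} [Subsingleton T.Q] {σ : Equiv.Perm (Fin n)}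
    (hout : ∀ a p, T.out a p = [σ a]) (q : T.Q) (y : ℕ → Fin n) :
    T.stateMap q y = fun i => σ (y i) := by
  rw [← eq_stateMap (nondegenerate_of_letter (lam := fun a _ => σ a) hout)
    fun _ y i => σ (y i)]
  intro a q y
  rw [hout]
  funext i
  cases i <;> simp

theorem isHomeomorph_map_perm (σ : Equiv.Perm (Fin n)) :
    IsHomeomorph fun (y : ℕ → Fin n) i => σ (y i) :=
  (Homeomorph.piCongrRight fun _ : ℕ => σ.toHomeomorphOfDiscrete).isHomeomorph

theorem syncAt_zero_of_subsingleton (T : Transducer n) [Subsingleton T.Q] : T.SyncAt 0 :=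
  fun _ _ _ _ => Subsingleton.elim _ _

theorem isHomeoState_of_subsingleton {T : Transducer n} [Subsingleton T.Q]
    {σ : Equiv.Perm (Fin n)} (hout : ∀ a p, T.out a p = [σ a]) (q : T.Q) : T.IsHomeoState q := by
  rw [IsHomeoState, funext (stateMap_of_subsingleton hout q)]
  exact isHomeomorph_map_perm σ

theorem isCore_of_subsingleton (T : Transducer n) [Subsingleton T.Q] : T.IsCore :=
  Set.eq_univ_of_forall fun _ =>
    ⟨0, syncAt_zero_of_subsingleton T, [], rfl, fun _ => Subsingleton.elim _ _⟩

theorem memSO_of_subsingleton (hn : 2 ≤ n) {T : Transducer n} [Subsingleton T.Q] [Nonempty T.Q]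
    {σ : Equiv.Perm (Fin n)} (hout : ∀ a p, T.out a p = [σ a]) : T.MemSO where
  finite := inferInstance
  nonempty := inferInstance
  nondegenerate := nondegenerate_of_letter (lam := fun a _ => σ a) hout
  minimal := ⟨fun _ _ _ => Subsingleton.elim _ _,
    fun q => lam_nil_eq_nil_of_surjective hn (isHomeoState_of_subsingleton hout q).surjective,
    fun _ _ => ⟨[], Subsingleton.elim _ _⟩⟩
  stronglySynchronizing := ⟨0, syncAt_zero_of_subsingleton T⟩
  isCore := isCore_of_subsingleton T
  injective q := (isHomeoState_of_subsingleton hout q).injective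
  clopen_image q := by
    rw [(isHomeoState_of_subsingleton hout q).surjective.range_eq]
    exact isClopen_univ

theorem memH_of_subsingleton (hn : 2 ≤ n) {T : Transducer n} [Subsingleton T.Q] [Nonempty T.Q]
    {σ : Equiv.Perm (Fin n)} (hout : ∀ a p, T.out a p = [σ a]) : T.MemH := by
  have : Subsingleton (ofPerm σ⁻¹).Q := inferInstanceAs (Subsingleton Unit)
  have : Nonempty (ofPerm σ⁻¹).Q := inferInstanceAs (Nonempty Unit)
  have hout' : ∀ a p, (ofPerm σ⁻¹).out a p = [σ⁻¹ a] := fun _ _ => rfl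
  have h1 := memSO_of_subsingleton hn hout
  have h2 := memSO_of_subsingleton hn hout'
  obtain ⟨p⟩ := h1.nonempty
  obtain ⟨r⟩ := h2.nonempty
  refine ⟨⟨h1, ofPerm σ⁻¹, h2, ?_, ?_⟩, fun a q => by rw [hout]; rfl,
    isHomeoState_of_subsingleton hout⟩
  · refine product_omegaEq_identity hn h1.nondegenerate h2.nondegenerate
      (syncAt_zero_of_subsingleton _) (syncAt_zero_of_subsingleton _) (m := 0)
      (fun _ _ _ => Nat.zero_le _) p r fun y => ?_
    rw [stateMap_of_subsingleton hout, stateMap_of_subsingleton hout']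
    simp
  · refine product_omegaEq_identity hn h2.nondegenerate h1.nondegenerate
      (syncAt_zero_of_subsingleton _) (syncAt_zero_of_subsingleton _) (m := 0)
      (fun _ _ _ => Nat.zero_le _) r p fun y => ?_
    rw [stateMap_of_subsingleton hout, stateMap_of_subsingleton hout']
    simp

/-- Synchronization at level 0 leaves only the empty word as first component of a recovered state,
so there is one recovered state and it applies the letter permutation of T. -/
theorem revRec_memH_of_subsingleton (hn : 2 ≤ n) {T : Transducer n} (hT : T.MemH)
    [Subsingleton T.Q] : T.revRec.MemH := by
  obtain ⟨hO, hsyn, hhomeo⟩ := hT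
  obtain ⟨lam, hlam⟩ := hsyn.exists_letter
  obtain ⟨q₀⟩ := hO.1.nonempty
  have hsurj := fun q => (hhomeo q).surjective
  let σ : Equiv.Perm (Fin n) := Equiv.ofBijective (fun a => lam a q₀)
    ⟨letter_injective hlam hsurj q₀, letter_surjective hlam hsurj q₀⟩
  have hk := syncAt_zero_of_subsingleton T
  have hRn := recover_nondegenerate hn hk hlam
  have hword : ∀ s : T.reverse.recover.Q, T.recWord s = [] := fun s =>
    List.length_eq_zero_iff.mp (Nat.le_zero.mp (length_recWord_le hn hk s))
  have : Subsingleton T.reverse.recover.Q := ⟨fun s t =>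
    recover_ext ((hword s).trans (hword t).symm) (Subsingleton.elim _ _)⟩
  have hmap : ∀ s, T.reverse.recover.stateMap s = fun y i => σ (y i) := by
    intro s
    funext y i
    rw [recover_stateMap hn hk q₀ hlam, hword, prependWord_nil]
    exact congrArg (lam (y i)) (Subsingleton.elim _ _)
  have hRsurj : ∀ s, Function.Surjective (T.reverse.recover.stateMap s) := fun s => by
    rw [hmap]
    exact (isHomeomorph_map_perm σ).surjective
  have hRc : T.reverse.recover.Nonconstant := fun s => by
    rw [(hRsurj s).range_eq]
    exact univ_nontrivial hn
  have hL := fun s => lam_nil_eq_nil_of_surjective hn (hRsurj s)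
  obtain ⟨s₀, hs₀⟩ := exists_mem_recStates hn hk q₀
  have hne : Nonempty T.reverse.recover.Q := ⟨⟨s₀, hs₀⟩⟩
  have : Subsingleton T.revRec.Q := T.reverse.recover.toMinRep_surjective.subsingleton
  have : Nonempty T.revRec.Q := hne.map T.reverse.recover.toMinRep
  refine memH_of_subsingleton hn (σ := σ) fun a c => ?_
  obtain ⟨s, rfl⟩ := T.reverse.recover.toMinRep_surjective c
  refine (minRep_out hRn hRc a s).trans ?_
  have h1 := lam_nil_append_out hRn hRc a s
  rw [hL, hL, List.nil_append, List.append_nil] at h1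
  rw [h1]
  -- No letter is stored before or after the step, so exactly one is written.
  have h2 := length_recover_outWord hn hk hlam [a] s
  rw [hword, hword] at h2
  have h3 : (T.reverse.recover.out a s).length = 1 := by simpa [outWord] using h2
  obtain ⟨b, hb⟩ := List.length_eq_one_iff.mp h3
  have h4 := congrFun (stateMap_cons hRn s a fun _ => a) 0
  rw [hmap, hb, prependWord_cons_zero] at h4
  rw [hb, ← h4]
  rfl

theorem subsingleton_iff_card_minRep (hn : 2 ≤ n) {T : Transducer n} (hT : T.MemSO) :
    Subsingleton T.Q ↔ Nat.card T.minRep.Q = 1 := by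
  have hinj := Minimal.toMinRep_injective hn hT.nondegenerate hT.minimal hT.injective
  have hne := hT.nonempty
  rw [Nat.card_eq_one_iff_unique]
  constructor
  · intro h
    exact ⟨T.toMinRep_surjective.subsingleton, hne.map T.toMinRep⟩
  · rintro ⟨h, -⟩
    exact hinj.subsingleton

/-! ### A marker transducer -/

/-- The transducer that applies the permutation `σ` to each letter that is preceded by the letter
`z`. -/
def marker (z : Fin n) (σ : Equiv.Perm (Fin n)) : Transducer n where
  Q := Bool
  trans a _ := decide (a = z)
  out a p := [bif p then σ a else a]

section Marker

/-- The output letters of the marker transducer. -/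
def markerLetter (z : Fin n) (σ : Equiv.Perm (Fin n)) (a : Fin n) (p : (marker z σ).Q) : Fin n :=
  bif (show Bool from p) then σ a else a

variable {z : Fin n} {σ : Equiv.Perm (Fin n)}

theorem marker_out (a : Fin n) (p : (marker z σ).Q) :
    (marker z σ).out a p = [markerLetter z σ a p] := rfl

theorem marker_synchronous : (marker z σ).Synchronous := fun _ _ => rfl

theorem marker_syncAt : (marker z σ).SyncAt 1 := by
  intro w hw p q
  obtain ⟨a, rfl⟩ := List.length_eq_one_iff.mp hw
  rfl

theorem marker_letter_letter (hz : σ z = z) (hσ : ∀ a, σ (σ a) = a) (a : Fin n)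
    (p : (marker z σ).Q) : markerLetter z σ (markerLetter z σ a p) p = a ∧
      ((markerLetter z σ a p = z) ↔ a = z) := by
  cases p
  · exact ⟨rfl, Iff.rfl⟩
  · exact ⟨hσ a, fun h => σ.injective (h.trans hz.symm), fun h => (congrArg σ h).trans hz⟩

/-- Since σ fixes z, the output has the letter z exactly where the input has it. The second pass
follows the same states and undoes each letter. -/
theorem marker_stateMap_stateMap (hz : σ z = z) (hσ : ∀ a, σ (σ a) = a) (p : (marker z σ).Q)
    (y : ℕ → Fin n) : (marker z σ).stateMap p ((marker z σ).stateMap p y) = y := by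
  have hM := (marker_synchronous (z := z) (σ := σ)).nondegenerate
  have key : ∀ a (p : (marker z σ).Q) y,
      (marker z σ).stateMap p ((marker z σ).stateMap p (prependWord [a] y))
        = prependWord [a] ((marker z σ).stateMap ((marker z σ).trans a p)
          ((marker z σ).stateMap ((marker z σ).trans a p) y)) := by
    intro a p y
    obtain ⟨h1, h2⟩ := marker_letter_letter hz hσ a p
    have h3 : (marker z σ).trans (markerLetter z σ a p) p = (marker z σ).trans a p :=
      decide_eq_decide.mpr h2
    rw [stateMap_cons hM, marker_out, stateMap_cons hM, marker_out, h1, h3]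
  -- An auxiliary transducer with the same transitions and unchanged letters: both the squares of
  -- the state maps and the identity satisfy its recursion.
  let D : Transducer n := { Q := Bool, trans := fun a _ => decide (a = z), out := fun a _ => [a] }
  have hD : D.Nondegenerate := Synchronous.nondegenerate fun _ _ => rfl
  have h1 : (fun (p : (marker z σ).Q) y => (marker z σ).stateMap p ((marker z σ).stateMap p y))
      = D.stateMap := eq_stateMap hD _ key
  have h2 : (fun (_ : D.Q) (y : ℕ → Fin n) => y) = D.stateMap :=
    eq_stateMap hD _ fun _ _ _ => rfl
  exact congrFun (congrFun (h1.trans h2.symm) p) y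

theorem marker_memO (hn : 2 ≤ n) (hz : σ z = z) (hσ : ∀ a, σ (σ a) = a) (hne : σ ≠ 1) :
    (marker z σ).MemO := by
  have hM := (marker_synchronous (z := z) (σ := σ)).nondegenerate
  have hinv := marker_stateMap_stateMap hz hσ
  have hsurj : ∀ p, Function.Surjective ((marker z σ).stateMap p) := fun p y => ⟨_, hinv p y⟩
  obtain ⟨b, hb⟩ : ∃ b, σ b ≠ b := by
    by_contra! h
    exact hne (Equiv.ext h)
  have hbz : b ≠ z := fun h => hb (h ▸ hz)
  have hreach : ∀ q : (marker z σ).Q, ∃ a, ∀ p, (marker z σ).run [a] p = q := by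
    intro q
    cases q
    · exact ⟨b, fun _ => decide_eq_false hbz⟩
    · exact ⟨z, fun _ => decide_eq_true rfl⟩
  have hSO : (marker z σ).MemSO :=
    { finite := inferInstanceAs (Finite Bool)
      nonempty := inferInstanceAs (Nonempty Bool)
      nondegenerate := hM
      minimal := by
        refine ⟨fun p q h => ?_, fun q => lam_nil_eq_nil_of_surjective hn (hsurj q),
          fun p q => ?_⟩
        -- The letter `b` is moved in the state `true` only, which separates the two states.
        · have h1 := congrFun (congrFun h (prependWord [b] fun _ => b)) 0
          rw [stateMap_cons hM, stateMap_cons hM, marker_out, marker_out, prependWord_cons_zero,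
            prependWord_cons_zero] at h1
          cases p <;> cases q
          · rfl
          · exact absurd h1.symm hb
          · exact absurd h1 hb
          · rfl
        · obtain ⟨a, ha⟩ := hreach q
          exact ⟨[a], ha p⟩
      stronglySynchronizing := ⟨1, marker_syncAt⟩
      isCore := Set.eq_univ_of_forall fun q => by
        obtain ⟨a, ha⟩ := hreach q
        exact ⟨1, marker_syncAt, [a], rfl, ha⟩
      injective := fun p => (show Function.Involutive _ from hinv p).injective
      clopen_image := fun p => by
        rw [(hsurj p).range_eq]
        exact isClopen_univ }
  have hprod : ((marker z σ).product (marker z σ)).OmegaEq (identity n) :=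
    product_omegaEq_identity hn hM hM marker_syncAt marker_syncAt (m := 1)
      (fun w p hw => by rw [length_outWord_of_synchronous marker_synchronous, hw])
      true true (hinv _)
  exact ⟨hSO, _, hSO, hprod, hprod⟩

/-- The shift commuting map of the marker transducer. -/
def markerMap (z : Fin n) (σ : Equiv.Perm (Fin n)) : (ℕ → Fin n) → ℕ → Fin n :=
  (marker z σ).pastOut 1 true (markerLetter z σ)

theorem markerMap_apply (x : ℕ → Fin n) (i : ℕ) :
    markerMap z σ x i = if x (i + 1) = z then σ (x i) else x i := by
  have h : markerMap z σ x i = bif decide (x (i + 1) = z) then σ (x i) else x i := rfl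
  rw [h]
  by_cases hx : x (i + 1) = z <;> simp [hx]

theorem markerMap_markerMap (hz : σ z = z) (hσ : ∀ a, σ (σ a) = a) (x : ℕ → Fin n) :
    markerMap z σ (markerMap z σ x) = x := by
  have h : ∀ i, markerMap z σ x i = z ↔ x i = z := by
    intro i
    rw [markerMap_apply]
    split_ifs
    · exact ⟨fun h => σ.injective (h.trans hz.symm), fun h => (congrArg σ h).trans hz⟩
    · rfl
  funext i
  rw [markerMap_apply]
  simp only [h]
  rw [markerMap_apply]
  split_ifs
  · exact hσ _
  · rfl

theorem continuous_markerMap : Continuous (markerMap z σ) := by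
  refine continuous_pi fun i => ?_
  have h : (fun x : ℕ → Fin n => markerMap z σ x i)
      = (fun p : Fin n × Fin n => if p.2 = z then σ p.1 else p.1) ∘ fun x => (x i, x (i + 1)) := by
    funext x
    exact markerMap_apply x i
  rw [h]
  exact continuous_of_discreteTopology.comp
    ((continuous_apply i).prodMk (continuous_apply (i + 1)))

/-! ### The reverse of the marker transducer -/

/-- Synchronization at level 1 gives the upper bound. The empty word is excluded because the pasts z
z … and b b … with b ≠ z end at different states. -/
theorem length_recWord_marker (hn : 2 ≤ n) (s : (marker z σ).reverse.recover.Q) :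
    ((marker z σ).recWord s).length = 1 := by
  have h1 := length_recWord_le hn marker_syncAt s
  have h2 : (marker z σ).recWord s ≠ [] := by
    intro h
    have hf := forced_of_mem_recStates marker_syncAt true s
    rw [h] at hf
    have : Nontrivial (Fin n) := Fin.nontrivial_iff_two_le.mpr hn
    obtain ⟨b, hb⟩ := exists_ne z
    have h3 := (hf fun _ => z).trans (hf fun _ => b).symm
    have h4 : (decide (z = z) : Bool) = decide (b = z) := h3
    simp [hb] at h4
  have := List.length_pos_iff.mpr h2
  omega

theorem recWord_trans_marker (hn : 2 ≤ n) (a : Fin n) (s : (marker z σ).reverse.recover.Q) :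
    (marker z σ).recWord ((marker z σ).reverse.recover.trans a s) = [a] := by
  have h1 := length_recWord_marker hn ((marker z σ).reverse.recover.trans a s)
  have h2 := length_recWord_marker hn s
  rw [recWord_trans hn marker_syncAt] at h1 ⊢
  obtain ⟨b, hb⟩ := List.length_eq_one_iff.mp h2
  rw [hb] at h1 ⊢
  generalize ((marker z σ).backL _ _).length = m at h1 ⊢
  simp at h1
  obtain rfl : m = 1 := by omega
  rfl

theorem recover_marker_ext (s t : (marker z σ).reverse.recover.Q)
    (h : (marker z σ).recWord s = (marker z σ).recWord t) : s = t :=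
  recover_ext h <| by
    rw [← forced_of_mem_recStates marker_syncAt true s fun _ => z, h,
      forced_of_mem_recStates marker_syncAt true t]

theorem recover_marker_trans_surjective (hn : 2 ≤ n) (t : (marker z σ).reverse.recover.Q) :
    ∃ a, ∀ s, (marker z σ).reverse.recover.run [a] s = t := by
  obtain ⟨a, ha⟩ := List.length_eq_one_iff.mp (length_recWord_marker hn t)
  refine ⟨a, fun s => recover_marker_ext _ _ ?_⟩
  rw [ha]
  exact recWord_trans_marker hn a s

theorem recover_marker_syncAt (hn : 2 ≤ n) : (marker z σ).reverse.recover.SyncAt 1 := by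
  intro w hw p q
  obtain ⟨a, rfl⟩ := List.length_eq_one_iff.mp hw
  apply recover_marker_ext
  exact (recWord_trans_marker hn a p).trans (recWord_trans_marker hn a q).symm

theorem recover_marker_stateMap (hn : 2 ≤ n) (s : (marker z σ).reverse.recover.Q)
    (y : ℕ → Fin n) : (marker z σ).reverse.recover.stateMap s y
      = markerMap z σ (prependWord ((marker z σ).recWord s) y) :=
  recover_stateMap hn marker_syncAt _ marker_out s y

theorem exists_recWord_marker_eq (hn : 2 ≤ n) (z : Fin n) (σ : Equiv.Perm (Fin n)) (a : Fin n) :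
    ∃ s, (marker z σ).recWord s = [a] := by
  obtain ⟨s, hs⟩ := exists_mem_recStates hn (marker_syncAt (z := z) (σ := σ)) true
  exact ⟨_, recWord_trans_marker hn a ⟨s, hs⟩⟩

theorem recover_marker_injective (hn : 2 ≤ n) (hz : σ z = z) (hσ : ∀ a, σ (σ a) = a)
    (s : (marker z σ).reverse.recover.Q) :
    Function.Injective ((marker z σ).reverse.recover.stateMap s) := by
  intro x y h
  rw [recover_marker_stateMap hn, recover_marker_stateMap hn] at h
  exact prependWord_injective _
    ((show Function.Involutive (markerMap z σ) from markerMap_markerMap hz hσ).injective h)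

theorem revRec_marker_memSO (hn : 2 ≤ n) (hz : σ z = z) (hσ : ∀ a, σ (σ a) = a) :
    (marker z σ).revRec.MemSO := by
  have : Finite (marker z σ).Q := inferInstanceAs (Finite Bool)
  have : Finite (marker z σ).reverse.recover.Q := recover_finite hn marker_syncAt
  have : Nonempty (marker z σ).reverse.recover.Q :=
    (exists_recWord_marker_eq hn z σ z).nonempty
  refine minRep_memSO hn (recover_nondegenerate hn marker_syncAt marker_out) (fun p q => ?_)
    ⟨1, recover_marker_syncAt hn⟩ (Set.eq_univ_of_forall fun q => ?_)
    (recover_marker_injective hn hz hσ) fun s => ?_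
  · obtain ⟨a, ha⟩ := recover_marker_trans_surjective hn q
    exact ⟨[a], ha p⟩
  · obtain ⟨a, ha⟩ := recover_marker_trans_surjective hn q
    exact ⟨1, recover_marker_syncAt hn, [a], rfl, ha⟩
  -- Because F is an involution, the image of a cone is also its preimage, hence clopen by
  -- continuity.
  · have h : Set.range ((marker z σ).reverse.recover.stateMap s)
        = markerMap z σ ⁻¹' cone ((marker z σ).recWord s) := by
      ext x
      rw [Set.mem_preimage, mem_cone_iff]
      constructor
      · rintro ⟨y, rfl⟩
        exact ⟨y, by rw [recover_marker_stateMap hn, markerMap_markerMap hz hσ]⟩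
      · rintro ⟨y, hy⟩
        exact ⟨y, by rw [recover_marker_stateMap hn, hy, markerMap_markerMap hz hσ]⟩
    rw [h]
    exact (isClopen_cone _).preimage continuous_markerMap

theorem length_lam_recover_marker (hn : 2 ≤ n) (hz : σ z = z) (hσ : ∀ a, σ (σ a) = a)
    (s : (marker z σ).reverse.recover.Q) :
    ((marker z σ).reverse.recover.Lam [] s).length ≤ 1 := by
  have hc := Nonconstant.of_injective hn (recover_marker_injective hn hz hσ)
  obtain ⟨a, ha⟩ := List.length_eq_one_iff.mp (length_recWord_marker hn s)
  have : Nontrivial (Fin n) := Fin.nontrivial_iff_two_le.mpr hn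
  obtain ⟨b, hb⟩ := exists_ne z
  by_contra! hlt
  rw [lam_nil] at hlt
  -- At position 1 the past a z z … gives σ(z) = z, while a b b … gives b, which is not preceded by
  -- z.
  have h := agree_greatestCommonPrefix (hc s) _ ⟨fun _ => z, rfl⟩ _ ⟨fun _ => b, rfl⟩ 1 hlt
  rw [recover_marker_stateMap hn, recover_marker_stateMap hn, ha, markerMap_apply,
    markerMap_apply] at h
  simp [hb, hz] at h
  exact hb h.symm

/-- The recovered state with word z induces y ↦ z F(y). Removing the prefix z leaves the involution
F, so the minimal representative is its own inverse. -/
theorem revRec_marker_memO (hn : 2 ≤ n) (hz : σ z = z) (hσ : ∀ a, σ (σ a) = a) :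
    (marker z σ).revRec.MemO := by
  have hR := recover_nondegenerate hn (marker_syncAt (z := z) (σ := σ)) marker_out
  have hc := Nonconstant.of_injective hn (recover_marker_injective hn hz hσ)
  have hSO := revRec_marker_memSO hn hz hσ
  have hn0 : 0 < n := by omega
  obtain ⟨s, hs⟩ := exists_recWord_marker_eq hn z σ z
  have hfix : ∀ y, (marker z σ).reverse.recover.stateMap s y
      = prependWord [z] (markerMap z σ y) := by
    intro y
    rw [recover_marker_stateMap hn, hs]
    refine (pastOut_cons _ _ _ _ z y).trans ?_
    congr 2
    generalize (marker z σ).pastState 1 true y = p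
    cases p
    · rfl
    · exact hz
  have hsurj : Function.Surjective (markerMap z σ) :=
    (show Function.Involutive (markerMap z σ) from markerMap_markerMap hz hσ).surjective
  have hL : (marker z σ).reverse.recover.Lam [] s = [z] := by
    rw [lam_nil, show (marker z σ).reverse.recover.stateMap s
      = prependWord [z] ∘ markerMap z σ from funext hfix, hsurj.range_comp, ← Set.image_univ,
      greatestCommonPrefix_image_prependWord (univ_nontrivial hn), greatestCommonPrefix_univ hn,
      List.append_nil]
  have hmap : ∀ y, (marker z σ).revRec.stateMap ((marker z σ).reverse.recover.toMinRep s) y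
      = markerMap z σ y := by
    intro y
    apply prependWord_injective [z]
    rw [← hfix, stateMap_eq_prependWord_minRep hR hc, hL]
    rfl
  -- On two letters the recovered transducer writes two; removing incomplete response costs at most
  -- the single letter of Λ(ε, p).
  have hlen : ∀ (w : List (Fin n)) (p : (marker z σ).revRec.Q), w.length = 2 →
      1 ≤ ((marker z σ).revRec.outWord w p).length := by
    intro w p hw
    obtain ⟨p, rfl⟩ := (marker z σ).reverse.recover.toMinRep_surjective p
    have h1 := congrArg List.length (minRep_outWord hR hc w p)
    have h2 := congrArg List.length (lam_nil_append_outWord hR hc w p)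
    have h3 := length_lam_recover_marker hn hz hσ p
    have h4 := length_recover_outWord hn marker_syncAt marker_out w p
    rw [length_recWord_marker hn, length_recWord_marker hn, hw] at h4
    rw [List.length_append, List.length_append] at h2
    refine le_of_le_of_eq ?_ h1.symm
    omega
  have hsync : (marker z σ).revRec.SyncAt 1 := (recover_marker_syncAt hn).minRep hR hc
  have hprod : ((marker z σ).revRec.product (marker z σ).revRec).OmegaEq (identity n) :=
    product_omegaEq_identity hn hSO.nondegenerate hSO.nondegenerate hsync hsync hlen
      ((marker z σ).reverse.recover.toMinRep s) ((marker z σ).reverse.recover.toMinRep s)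
      fun y => by rw [hmap, hmap, markerMap_markerMap hz hσ]
  exact ⟨hSO, _, hSO, hprod, hprod⟩

/-- For a letter b moved by σ, the values F(by) begin with b or σ(b), and both occur. So nothing is
stripped from this state and its map misses all words starting with z, while every state map of the
marker transducer is onto. -/
theorem revRec_marker_not_omegaEq (hn : 2 ≤ n) (hz : σ z = z) (hσ : ∀ a, σ (σ a) = a)
    (hne : σ ≠ 1) : ¬ (marker z σ).revRec.OmegaEq (marker z σ) := by
  rintro ⟨f, hf⟩
  have hR := recover_nondegenerate hn (marker_syncAt (z := z) (σ := σ)) marker_out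
  have hc := Nonconstant.of_injective hn (recover_marker_injective hn hz hσ)
  obtain ⟨b, hb⟩ : ∃ b, σ b ≠ b := by
    by_contra! h
    exact hne (Equiv.ext h)
  have hbz : b ≠ z := fun h => hb (h ▸ hz)
  obtain ⟨s, hs⟩ := exists_recWord_marker_eq hn z σ b
  have hval : ∀ y, (marker z σ).reverse.recover.stateMap s y 0 = if y 0 = z then σ b else b := by
    intro y
    rw [recover_marker_stateMap hn, hs, markerMap_apply]
    simp
  have hL : (marker z σ).reverse.recover.Lam [] s = [] := by
    rw [lam_nil]
    refine greatestCommonPrefix_eq (fun _ _ => rfl) ⟨fun _ => z, rfl⟩ ⟨fun _ => b, rfl⟩ ?_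
    simpa [hval, hbz] using hb
  let c : (marker z σ).revRec.Q := (marker z σ).reverse.recover.toMinRep s
  have hsurj : Function.Surjective ((marker z σ).revRec.stateMap c) := by
    rw [hf]
    exact fun y => ⟨_, marker_stateMap_stateMap hz hσ _ y⟩
  obtain ⟨y, hy⟩ := hsurj fun _ => z
  have h := stateMap_eq_prependWord_minRep hR hc s y
  rw [hL, prependWord_nil] at h
  have h0 := hval y
  rw [h, show (marker z σ).reverse.recover.minRep.stateMap _ y = _ from hy] at h0
  split_ifs at h0
  · exact hbz (σ.injective (h0.symm.trans hz.symm))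
  · exact hbz h0.symm

end Marker

end Transducer

theorem mainTheorem5 (n : ℕ) (hn : 2 ≤ n) :
    (∀ T : Transducer n, T.MemH → (T.revRec.MemH ↔ Nat.card T.minRep.Q = 1)) ∧
    (3 ≤ n → ∃ T : Transducer n, T.MemO ∧ T.revRec.MemO ∧ ¬ T.revRec.OmegaEq T) := by
  refine ⟨fun T hT => ?_, fun h3 => ?_⟩
  · rw [← Transducer.subsingleton_iff_card_minRep hn hT.1.1]
    exact ⟨Transducer.subsingleton_of_revRec hn hT,
      fun _ => Transducer.revRec_memH_of_subsingleton hn hT⟩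
  -- The hypothesis `3 ≤ n` provides a marker letter and two further letters to exchange.
  · let z : Fin n := ⟨0, by omega⟩
    let a : Fin n := ⟨1, by omega⟩
    let b : Fin n := ⟨2, by omega⟩
    have hz : Equiv.swap a b z = z :=
      Equiv.swap_apply_of_ne_of_ne (by simp [z, a]) (by simp [z, b])
    have hσ : ∀ c, Equiv.swap a b (Equiv.swap a b c) = c := fun c => Equiv.congr_fun (Equiv.swap_mul_self a b) c
    have hne : Equiv.swap a b ≠ 1 := by
      rw [Ne, Equiv.swap_eq_one_iff]
      simp [a, b]
    exact ⟨_, Transducer.marker_memO hn hz hσ hne, Transducer.revRec_marker_memO hn hz hσ,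
      Transducer.revRec_marker_not_omegaEq hn hz hσ hne⟩
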